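/- Let $n\ge 4$. The cubic hypersurfaces in $\mathbb P^n=\mathbb P^n_{\mathbb C}$ form the projective space $\mathbb P(\mathrm{Sym}^3\mathbb C^{n+1})$, which is given the Zariski topology. Let $X=\{F=0\}\subset\mathbb P^n$ be a smooth cubic hypersurface. A line $L\subset X$ is *of the second type* if there is a linear subspace $P^{n-2}\subset\mathbb P^n$ of codimension two, containing $L$, that is tangent to $X$ at all points of $L$. In suitable linear coordinates in which $L=\{x_2=\dots=x_n=0\}$, one then has $$F=x_2x_0^2+x_3x_1^2+\sum_{2\le i,j\le n}x_ix_jL_{ij}(x_0,x_1)+C(x_2,\dots,x_n),$$ where the $L_{ij}=L_{ji}$ are linear forms and $C$ is a cubic form. A line $L\subset X$ of the second type is a *higher triple line* if, in such coordinates, the columns of the matrix of linear forms $(L_{ij}(x_0,x_1))_{4\le i,j\le n}$ are linearly dependent over $\mathbb C$. Then the set of smooth cubic hypersurfaces in $\mathbb P^n$ that contain a higher triple line is a closed subset of the space of all smooth cubic hypersurfaces, of codimension at least one there, and its closure has codimension at least one in the space $\mathbb P(\mathrm{Sym}^3\mathbb C^{n+1})$ of all cubic hypersurfaces. In particular, a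 general cubic hypersurface contains no higher triple line: there is a nonempty (hence dense) Zariski open subset $U\subset\mathbb P(\mathrm{Sym}^3\mathbb C^{n+1})$ such that every $X\in U$ is smooth and contains no higher triple line. -/

import Mathlib

open MvPolynomial

noncomputable section

/-- Homogeneous cubic forms in the coordinates `x_0, …, x_n`, i.e. `Sym³` of the space of linear
forms on `ℂ^{n+1}`. -/
abbrev CubicForm (n : ℕ) : Type := homogeneousSubmodule (Fin (n + 1)) ℂ 3

/-- The projective space of all cubic hypersurfaces in `ℙⁿ` over `ℂ`. -/
def CubicHypersurface (n : ℕ) : Type := Projectivization ℂ (CubicForm n)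

/-- The exponents of the cubic monomials in `x_0, …, x_n`; they index the homogeneous coordinates
on the projective space of cubics. -/
abbrev CubicMonomial (n : ℕ) : Type := {m : Fin (n + 1) →₀ ℕ // m.degree = 3}

namespace CubicHypersurface

variable {n : ℕ}

/-- A nonzero equation of the hypersurface, well defined up to a nonzero scalar. -/
def equation (X : CubicHypersurface n) : MvPolynomial (Fin (n + 1)) ℂ :=
  (Projectivization.rep (K := ℂ) (V := CubicForm n) X).1

/-- The homogeneous coordinates of a cubic hypersurface: the coefficients of its equation. -/
def coords (X : CubicHypersurface n) : CubicMonomial n → ℂ := fun m => coeff m.1 X.equation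

/-- The common zero locus, in the projective space of cubics, of a set of polynomials in the
homogeneous coordinates. -/
def zeroLocus (S : Set (MvPolynomial (CubicMonomial n) ℂ)) : Set (CubicHypersurface n) :=
  {X | ∀ P ∈ S, eval X.coords P = 0}

/-- A set of cubics is Zariski closed if it is the zero locus of a set of homogeneous
polynomials in the coefficients. -/
def IsZariskiClosed (Z : Set (CubicHypersurface n)) : Prop :=
  ∃ S : Set (MvPolynomial (CubicMonomial n) ℂ),
    (∀ P ∈ S, ∃ d : ℕ, P.IsHomogeneous d) ∧ Z = zeroLocus S

/-- The Zariski topology on the projective space of cubics. -/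
instance : TopologicalSpace (CubicHypersurface n) :=
  TopologicalSpace.ofClosed {Z | IsZariskiClosed Z}
    ⟨{1}, by rintro P rfl; exact ⟨0, isHomogeneous_one _ _⟩, by ext X; simp [zeroLocus]⟩
    (by
      intro A hA
      refine ⟨{P | ∃ S : Set (MvPolynomial (CubicMonomial n) ℂ),
        (∀ P ∈ S, ∃ d : ℕ, P.IsHomogeneous d) ∧ zeroLocus S ∈ A ∧ P ∈ S}, ?_, ?_⟩
      · rintro P ⟨S, hS, -, hP⟩
        exact hS P hP
      · ext X
        constructor
        · rintro hX P ⟨S, -, hSA, hP⟩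
          exact hX _ hSA P hP
        · intro hX Z hZ
          obtain ⟨S, hS, rfl⟩ := hA hZ
          exact fun P hP => hX P ⟨S, hS, hZ, hP⟩)
    (by
      rintro _ ⟨S, hS, rfl⟩ _ ⟨T, hT, rfl⟩
      refine ⟨{R | ∃ P ∈ S, ∃ Q ∈ T, R = P * Q}, ?_, ?_⟩
      · rintro _ ⟨P, hP, Q, hQ, rfl⟩
        obtain ⟨d, hd⟩ := hS P hP
        obtain ⟨e, he⟩ := hT Q hQ
        exact ⟨d + e, hd.mul he⟩
      · ext X
        constructor
        · rintro (hX | hX) _ ⟨P, hP, Q, hQ, rfl⟩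
          · simp [hX P hP]
          · simp [hX Q hQ]
        · intro hX
          by_contra h
          rw [Set.mem_union, not_or] at h
          obtain ⟨h1, h2⟩ := h
          simp only [zeroLocus, Set.mem_ofPred_eq, not_forall] at h1 h2
          obtain ⟨P, hP, hP0⟩ := h1
          obtain ⟨Q, hQ, hQ0⟩ := h2
          have := hX (P * Q) ⟨P, hP, Q, hQ, rfl⟩
          rw [map_mul] at this
          exact (mul_ne_zero hP0 hQ0) this)

end CubicHypersurface

/-- The codimension of (the closure of) a subset `Y` of a topological space: the infimum, over the
irreducible closed subsets `Z` of the closure, of the codimension of `Z`, which is the supremum of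
the lengths of chains of irreducible closed subsets starting with `Z`. -/
def topologicalCodim {T : Type*} [TopologicalSpace T] (Y : Set T) : ℕ∞ :=
  ⨅ Z : {Z : TopologicalSpace.IrreducibleCloseds T // (Z : Set T) ⊆ closure Y},
    Order.coheight Z.1

/-- The hypersurface `F = 0` in `ℙⁿ` is smooth: the gradient of `F` vanishes at none of its
points. -/
def IsSmoothForm {n : ℕ} (F : MvPolynomial (Fin (n + 1)) ℂ) : Prop :=
  ∀ p : Fin (n + 1) → ℂ, p ≠ 0 → eval p F = 0 → ∃ i, eval p (pderiv i F) ≠ 0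

/-- The linear subspace `ℙ(W)` is tangent to the hypersurface `F = 0` at all points of the linear
subspace `ℙ(L)`: every point `p` of `ℙ(L)` lies on the hypersurface, and `ℙ(W)` contains `p` and
is contained in the projective tangent space `∑ w_i ∂F/∂x_i(p) = 0` at `p`. -/
def IsTangentAlong {n : ℕ} (F : MvPolynomial (Fin (n + 1)) ℂ)
    (W L : Submodule ℂ (Fin (n + 1) → ℂ)) : Prop :=
  L ≤ W ∧ ∀ p ∈ L, eval p F = 0 ∧ ∀ w ∈ W, ∑ i, w i * eval p (pderiv i F) = 0

/-- `ℙ(L)` is a line of the second type on the hypersurface `F = 0`: some linear subspace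
`ℙ(W)` of codimension two is tangent to the hypersurface along the line `ℙ(L)`. -/
def IsLineOfSecondType {n : ℕ} (F : MvPolynomial (Fin (n + 1)) ℂ)
    (L : Submodule ℂ (Fin (n + 1) → ℂ)) : Prop :=
  Module.finrank ℂ L = 2 ∧
    ∃ W : Submodule ℂ (Fin (n + 1) → ℂ),
      Module.finrank ℂ ((Fin (n + 1) → ℂ) ⧸ W) = 2 ∧ IsTangentAlong F W L

/-- The expression of `F` in the linear coordinates attached to a basis `b` of `ℂ^{n+1}`, i.e. the
polynomial `F(x_0 b_0 + ⋯ + x_n b_n)`. -/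
def inCoordinates {n : ℕ} (b : Module.Basis (Fin (n + 1)) ℂ (Fin (n + 1) → ℂ))
    (F : MvPolynomial (Fin (n + 1)) ℂ) : MvPolynomial (Fin (n + 1)) ℂ :=
  bind₁ (fun i => ∑ j, C (b j i) * X j) F

/-- The linear form `A_ij x_0 + B_ij x_1`. -/
def linearEntry {n : ℕ} (A B : Matrix (Fin (n + 1)) (Fin (n + 1)) ℂ) (i j : Fin (n + 1)) :
    MvPolynomial (Fin (n + 1)) ℂ :=
  C (A i j) * X 0 + C (B i j) * X 1

/-- In the coordinates attached to `b`, the line `ℙ(L)` is `x_2 = ⋯ = x_n = 0` and `F` equals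
`x_2 x_0² + x_3 x_1² + ∑_{2 ≤ i, j ≤ n} x_i x_j L_ij(x_0, x_1) + G(x_2, …, x_n)`
with `L_ij = L_ji = A_ij x_0 + B_ij x_1` and `G` a cubic form. -/
def IsSecondTypeNormalForm {n : ℕ} (F : MvPolynomial (Fin (n + 1)) ℂ)
    (L : Submodule ℂ (Fin (n + 1) → ℂ)) (b : Module.Basis (Fin (n + 1)) ℂ (Fin (n + 1) → ℂ))
    (A B : Matrix (Fin (n + 1)) (Fin (n + 1)) ℂ) : Prop :=
  L = Submodule.span ℂ {b 0, b 1} ∧ A.IsSymm ∧ B.IsSymm ∧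
    ∃ G : MvPolynomial (Fin (n + 1)) ℂ,
      G.IsHomogeneous 3 ∧ (∀ i ∈ G.vars, 2 ≤ (i : ℕ)) ∧
      inCoordinates b F = X 2 * X 0 ^ 2 + X 3 * X 1 ^ 2 +
        (∑ i ∈ Finset.univ.filter (fun k : Fin (n + 1) => 2 ≤ (k : ℕ)),
          ∑ j ∈ Finset.univ.filter (fun k : Fin (n + 1) => 2 ≤ (k : ℕ)),
            X i * X j * linearEntry A B i j) + G

/-- The matrix of linear forms `S = (L_ij)_{4 ≤ i, j ≤ n}` degenerates: its columns are linearly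
dependent over `ℂ`. -/
def SecondOrderDegenerates {n : ℕ} (A B : Matrix (Fin (n + 1)) (Fin (n + 1)) ℂ) : Prop :=
  ¬ LinearIndependent ℂ (fun (j : {k : Fin (n + 1) // 4 ≤ (k : ℕ)})
    (i : {k : Fin (n + 1) // 4 ≤ (k : ℕ)}) => linearEntry A B i.1 j.1)

/-- `ℙ(L)` is a higher triple line on the hypersurface `F = 0`. -/
def IsHigherTripleLine {n : ℕ} (F : MvPolynomial (Fin (n + 1)) ℂ)
    (L : Submodule ℂ (Fin (n + 1) → ℂ)) : Prop :=
  IsLineOfSecondType F L ∧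
    ∃ (b : Module.Basis (Fin (n + 1)) ℂ (Fin (n + 1) → ℂ))
      (A B : Matrix (Fin (n + 1)) (Fin (n + 1)) ℂ),
      IsSecondTypeNormalForm F L b A B ∧ SecondOrderDegenerates A B

namespace CubicHypersurface

/-- The cubic hypersurface is smooth. -/
def IsSmooth {n : ℕ} (X : CubicHypersurface n) : Prop := IsSmoothForm X.equation

/-- The cubic hypersurface contains a higher triple line. -/
def HasHigherTripleLine {n : ℕ} (X : CubicHypersurface n) : Prop :=
  ∃ L : Submodule ℂ (Fin (n + 1) → ℂ), IsHigherTripleLine X.equation L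

end CubicHypersurface

/-- The space of smooth cubic hypersurfaces in `ℙⁿ`, with the Zariski (subspace) topology. -/
abbrev SmoothCubicHypersurface (n : ℕ) : Type := {X : CubicHypersurface n // X.IsSmooth}

end

/-! Let T be the symmetric trilinear form with T(x, x, x) = 6F(x). A smooth cubic has a higher
triple line exactly when there is a flag L ⊂ M ⊂ W of dimension two, dimension three and codimension
two with T(L, M, W) = 0 (`HasTripleFlag`, `CubicHypersurface.hasHigherTripleLine_iff`). Indeed,
tangency of W along L means T(L, L, W) = 0, and a dependency between the columns of (L_ij) is a
vector v of W outside L with T(L, v, W) = 0; then M = L + ⟨v⟩. Smoothness serves only to recover the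
normal form from a flag: the quadratic forms T(l, l, ·) on L, with values modulo W, have no common
zero, hence can be diagonalized simultaneously (`exists_simultaneous_diagonalization`,
`exists_adaptedBasis`).

The flag condition makes sense for every cubic, and flags form a projective variety, so elimination
theory shows that the cubics with a flag form a closed set (`elimination_of_homogeneous`,
`algPred_hasTripleFlag`).

This closed set is not everything, by a dimension count. With s = n - 4, flags of this type depend
on 8 + 5s parameters, while T(L, M, W) = 0 for a fixed flag kills at least 9 + 5s coefficients. The
coefficients of such cubics are therefore polynomials in fewer parameters than there are
coefficients, and satisfy a nontrivial relation (`exists_relation_of_hasTripleFlag`).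

The space of cubics is irreducible and its smooth locus is open and nonempty, so the smooth cubics
without a flag form a nonempty dense open set, and both codimension bounds follow. -/

set_option linter.unusedSectionVars false

/-! ### The symmetric trilinear form of a cubic and linear substitutions. -/

noncomputable section PolarForm

variable {ι : Type*} [Fintype ι] [DecidableEq ι]

/-- The third partial derivatives of `F` at the origin. -/
def thirdDerivs (F : MvPolynomial ι ℂ) (i j k : ι) : ℂ :=
  coeff 0 (pderiv k (pderiv j (pderiv i F)))

/-- The trilinear form with a given array of coefficients. -/
def trilinearOf (t : ι → ι → ι → ℂ) :
    (ι → ℂ) →ₗ[ℂ] (ι → ℂ) →ₗ[ℂ] (ι → ℂ) →ₗ[ℂ] ℂ :=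
  ∑ i, ∑ j, ∑ k, t i j k • ((LinearMap.proj i : (ι → ℂ) →ₗ[ℂ] ℂ).smulRight
    ((LinearMap.proj j : (ι → ℂ) →ₗ[ℂ] ℂ).smulRight (LinearMap.proj k : (ι → ℂ) →ₗ[ℂ] ℂ)))

/-- The symmetric trilinear form `T` with `T(x, x, x) = 6 F(x)`, for a cubic form `F`. -/
def polarForm (F : MvPolynomial ι ℂ) : (ι → ℂ) →ₗ[ℂ] (ι → ℂ) →ₗ[ℂ] (ι → ℂ) →ₗ[ℂ] ℂ :=
  trilinearOf (thirdDerivs F)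

lemma trilinearOf_apply (t : ι → ι → ι → ℂ) (u v w : ι → ℂ) :
    trilinearOf t u v w = ∑ i, ∑ j, ∑ k, t i j k * (u i * (v j * w k)) := by
  simp [trilinearOf, LinearMap.sum_apply]

lemma polarForm_apply (F : MvPolynomial ι ℂ) (u v w : ι → ℂ) :
    polarForm F u v w = ∑ i, ∑ j, ∑ k, thirdDerivs F i j k * (u i * (v j * w k)) :=
  trilinearOf_apply _ _ _ _

lemma pderiv_comm' (i j : ι) (F : MvPolynomial ι ℂ) :
    pderiv i (pderiv j F) = pderiv j (pderiv i F) := by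
  ext m
  simp only [coeff_pderiv, Finsupp.add_apply]
  rw [add_right_comm]
  rcases eq_or_ne i j with rfl | h
  · rfl
  · simp [h, h.symm]
    ring

lemma thirdDerivs_swap_left (F : MvPolynomial ι ℂ) (i j k : ι) :
    thirdDerivs F i j k = thirdDerivs F j i k := by
  rw [thirdDerivs, pderiv_comm' j i, thirdDerivs]

lemma thirdDerivs_swap_right (F : MvPolynomial ι ℂ) (i j k : ι) :
    thirdDerivs F i j k = thirdDerivs F i k j := by
  rw [thirdDerivs, pderiv_comm' k j, thirdDerivs]

lemma polarForm_swap_left (F : MvPolynomial ι ℂ) (u v w : ι → ℂ) :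
    polarForm F u v w = polarForm F v u w := by
  rw [polarForm_apply, polarForm_apply, Finset.sum_comm]
  refine Finset.sum_congr rfl fun i _ => Finset.sum_congr rfl fun j _ =>
    Finset.sum_congr rfl fun k _ => ?_
  rw [thirdDerivs_swap_left]
  ring

lemma polarForm_swap_right (F : MvPolynomial ι ℂ) (u v w : ι → ℂ) :
    polarForm F u v w = polarForm F u w v := by
  rw [polarForm_apply, polarForm_apply]
  refine Finset.sum_congr rfl fun i _ => ?_
  rw [Finset.sum_comm]
  refine Finset.sum_congr rfl fun j _ => Finset.sum_congr rfl fun k _ => ?_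
  rw [thirdDerivs_swap_right]
  ring

lemma MvPolynomial.IsHomogeneous.eval_euler {F : MvPolynomial ι ℂ} {d : ℕ}
    (hF : F.IsHomogeneous d) (p : ι → ℂ) :
    ∑ i, p i * eval p (pderiv i F) = d * eval p F := by
  have := congrArg (eval p) hF.sum_X_mul_pderiv
  simpa using this

lemma MvPolynomial.IsHomogeneous.eval_eq_coeff_zero {F : MvPolynomial ι ℂ}
    (hF : F.IsHomogeneous 0) (p : ι → ℂ) : eval p F = coeff 0 F := by
  rw [← totalDegree_zero_iff_isHomogeneous] at hF
  conv_lhs => rw [totalDegree_eq_zero_iff_eq_C.1 hF]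
  simp

/-- Euler's identity is applied to the first derivatives, of degree 2, and to the second ones, of
degree 1; the third derivatives are constants. The factor 2 is the degree of the gradient. -/
lemma polarForm_diag_eq_gradient {F : MvPolynomial ι ℂ} (hF : F.IsHomogeneous 3)
    (p w : ι → ℂ) : polarForm F w p p = 2 * ∑ i, w i * eval p (pderiv i F) := by
  rw [polarForm_apply, Finset.mul_sum]
  refine Finset.sum_congr rfl fun i _ => ?_
  have h2 : (pderiv i F).IsHomogeneous 2 := hF.pderiv
  have e2 := h2.eval_euler p
  push_cast at e2
  rw [mul_left_comm, ← e2, Finset.mul_sum]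
  refine Finset.sum_congr rfl fun j _ => ?_
  have h1 : (pderiv j (pderiv i F)).IsHomogeneous 1 := h2.pderiv
  have e1 := h1.eval_euler p
  rw [Nat.cast_one, one_mul] at e1
  rw [← e1, Finset.mul_sum, Finset.mul_sum]
  refine Finset.sum_congr rfl fun k _ => ?_
  have h0 : (pderiv k (pderiv j (pderiv i F))).IsHomogeneous 0 := h1.pderiv
  rw [h0.eval_eq_coeff_zero, thirdDerivs]
  ring

lemma polarForm_self {F : MvPolynomial ι ℂ} (hF : F.IsHomogeneous 3) (p : ι → ℂ) :
    polarForm F p p p = 6 * eval p F := by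
  rw [polarForm_diag_eq_gradient hF, hF.eval_euler]
  push_cast
  ring

lemma gradient_eq_polarForm {F : MvPolynomial ι ℂ} (hF : F.IsHomogeneous 3)
    (p w : ι → ℂ) : ∑ i, w i * eval p (pderiv i F) = polarForm F p p w / 2 := by
  rw [polarForm_swap_right, polarForm_swap_left, polarForm_diag_eq_gradient hF]
  ring

/-- Polarization: a symmetric trilinear form is determined by its cubic form. -/
lemma trilinear_polarization {V : Type*} [AddCommGroup V] [Module ℂ V]
    {T : V →ₗ[ℂ] V →ₗ[ℂ] V →ₗ[ℂ] ℂ}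
    (h1 : ∀ u v w, T u v w = T v u w) (h2 : ∀ u v w, T u v w = T u w v) (u v w : V) :
    6 * T u v w = T (u + v + w) (u + v + w) (u + v + w) - T (u + v) (u + v) (u + v)
      - T (u + w) (u + w) (u + w) - T (v + w) (v + w) (v + w)
      + T u u u + T v v v + T w w w := by
  simp only [map_add, LinearMap.add_apply]
  have a1 := h2 u w v
  have a2 := h1 v u w
  have a3 := h2 v w u
  have a4 := h1 w u v
  have a5 := h2 w v u
  linear_combination (-3) * a1 - 2 * a2 - a3 - 2 * a4 - a5

lemma trilinear_ext {V : Type*} [AddCommGroup V] [Module ℂ V]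
    {T T' : V →ₗ[ℂ] V →ₗ[ℂ] V →ₗ[ℂ] ℂ}
    (h1 : ∀ u v w, T u v w = T v u w) (h2 : ∀ u v w, T u v w = T u w v)
    (h1' : ∀ u v w, T' u v w = T' v u w) (h2' : ∀ u v w, T' u v w = T' u w v)
    (h : ∀ u, T u u u = T' u u u) (u v w : V) : T u v w = T' u v w := by
  have e := trilinear_polarization h1 h2 u v w
  have e' := trilinear_polarization h1' h2' u v w
  simp only [h] at e
  rw [← e'] at e
  exact mul_left_cancel₀ (by norm_num) e

/-- The linear substitution sending the coordinate `x_i` to `∑_a b_a(i) x_a`. -/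
def linearSubst (b : ι → ι → ℂ) (F : MvPolynomial ι ℂ) : MvPolynomial ι ℂ :=
  bind₁ (fun i => ∑ j, C (b j i) * X j) F

lemma eval_linearSubst (b : ι → ι → ℂ) (F : MvPolynomial ι ℂ) (x : ι → ℂ) :
    eval x (linearSubst b F) = eval (∑ a, x a • b a) F := by
  rw [linearSubst, ← coe_aeval_eq_eval, ← coe_aeval_eq_eval]
  simp only [RingHom.coe_coe]
  rw [aeval_bind₁]
  congr 2
  ext i
  simp [Finset.sum_apply, mul_comm]

lemma isHomogeneous_linearSubst (b : ι → ι → ℂ) {F : MvPolynomial ι ℂ} {d : ℕ}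
    (hF : F.IsHomogeneous d) : (linearSubst b F).IsHomogeneous d := by
  have := hF.aeval (fun i => ∑ j, C (b j i) * X j) (n := 1) fun i =>
    IsHomogeneous.sum _ _ _ fun j _ => isHomogeneous_C_mul_X _ _
  rw [one_mul] at this
  exact this

/-- Both sides are symmetric trilinear and have the same cubic form, so polarization identifies
them; no chain rule is needed. -/
lemma polarForm_linearSubst (b : ι → ι → ℂ) {F : MvPolynomial ι ℂ} (hF : F.IsHomogeneous 3)
    (u v w : ι → ℂ) : polarForm (linearSubst b F) u v w =
      polarForm F (∑ a, u a • b a) (∑ a, v a • b a) (∑ a, w a • b a) := by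
  let e : (ι → ℂ) →ₗ[ℂ] (ι → ℂ) := Fintype.linearCombination ℂ b
  have he : ∀ u, ∑ a, u a • b a = e u := fun u => rfl
  let T' : (ι → ℂ) →ₗ[ℂ] (ι → ℂ) →ₗ[ℂ] (ι → ℂ) →ₗ[ℂ] ℂ :=
    ((polarForm F).compl₁₂ e e).compr₂ (LinearMap.lcomp ℂ ℂ e)
  have hT' : ∀ u v w, T' u v w = polarForm F (e u) (e v) (e w) := fun u v w => rfl
  rw [he, he, he, ← hT']
  refine trilinear_ext (polarForm_swap_left _) (polarForm_swap_right _) ?_ ?_ ?_ u v w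
  · intro u v w
    rw [hT', hT', polarForm_swap_left]
  · intro u v w
    rw [hT', hT', polarForm_swap_right]
  · intro u
    rw [hT', polarForm_self hF, polarForm_self (isHomogeneous_linearSubst b hF),
      eval_linearSubst, he]

lemma polarForm_single (F : MvPolynomial ι ℂ) (a b c : ι) :
    polarForm F (Pi.single a 1) (Pi.single b 1) (Pi.single c 1) = thirdDerivs F a b c := by
  rw [polarForm_apply, Finset.sum_eq_single a, Finset.sum_eq_single b, Finset.sum_eq_single c]
  all_goals simp +contextual

lemma thirdDerivs_linearSubst (b : ι → ι → ℂ) {F : MvPolynomial ι ℂ} (hF : F.IsHomogeneous 3)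
    (i j k : ι) : thirdDerivs (linearSubst b F) i j k = polarForm F (b i) (b j) (b k) := by
  rw [← polarForm_single, polarForm_linearSubst b hF]
  simp [Pi.single_apply]

/-- The multiplicity relating a third derivative to a coefficient. -/
def derivFactor (i j k : ι) : ℂ :=
  ((Finsupp.single k 1 + Finsupp.single j 1 : ι →₀ ℕ) i + 1) *
    ((Finsupp.single k 1 : ι →₀ ℕ) j + 1)

lemma derivFactor_ne_zero (i j k : ι) : derivFactor i j k ≠ 0 := by
  exact mul_ne_zero (Nat.cast_add_one_ne_zero _) (Nat.cast_add_one_ne_zero _)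

/-- The exponent of `x_i x_j x_k`. -/
def tripleExp (i j k : ι) : ι →₀ ℕ :=
  Finsupp.single k 1 + Finsupp.single j 1 + Finsupp.single i 1

lemma degree_tripleExp (i j k : ι) : (tripleExp i j k).degree = 3 := by
  simp [tripleExp]

/-- The factor never vanishes, so the vanishing of T on basis vectors is the vanishing of a
coefficient in these coordinates. -/
lemma thirdDerivs_eq_coeff (F : MvPolynomial ι ℂ) (i j k : ι) :
    thirdDerivs F i j k = coeff (tripleExp i j k) F * derivFactor i j k := by
  rw [thirdDerivs, coeff_pderiv, coeff_pderiv, coeff_pderiv, derivFactor, tripleExp]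
  simp
  ring

end PolarForm

/-! ### Projective Nullstellensatz and elimination theory. -/

noncomputable section Elimination

section Nullstellensatz

variable {τ K : Type*} [Fintype τ] [DecidableEq τ] [Field K]

instance monomialsFintype (d : ℕ) : Fintype {m : τ →₀ ℕ // m.degree = d} :=
  ((Finsupp.finite_of_degree_le d).subset fun _ h => le_of_eq h :
    {m : τ →₀ ℕ | m.degree = d}.Finite).fintype

/-- The coefficients in degree `d`. -/
def coeffsInDegree (τ : Type*) (K : Type*) [Field K] (d : ℕ) :
    MvPolynomial τ K →ₗ[K] ({m : τ →₀ ℕ // m.degree = d} → K) :=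
  LinearMap.pi fun m => lcoeff K m.1

lemma coeffsInDegree_apply (d : ℕ) (p : MvPolynomial τ K) (m : {m : τ →₀ ℕ // m.degree = d}) :
    coeffsInDegree τ K d p m = coeff m.1 p := rfl

lemma coeffsInDegree_eq_zero {d e : ℕ} {p : MvPolynomial τ K} (hp : p.IsHomogeneous e)
    (h : e ≠ d) : coeffsInDegree τ K d p = 0 := by
  ext m
  refine hp.coeff_eq_zero ?_
  rw [m.2]
  exact h.symm

/-- The monomial multiples of degree `d` of the members of a set of homogeneous polynomials. -/
def multiplesInDegree (S : Set (MvPolynomial τ K)) (d : ℕ) : Set (MvPolynomial τ K) :=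
  {q | ∃ u : τ →₀ ℕ, ∃ p ∈ S, q = monomial u 1 * p ∧ q.IsHomogeneous d}

lemma mem_span_monomial_mul {S : Set (MvPolynomial τ K)} {q : MvPolynomial τ K}
    (hq : q ∈ Ideal.span S) :
    q ∈ Submodule.span K {q | ∃ u : τ →₀ ℕ, ∃ p ∈ S, q = monomial u 1 * p} := by
  induction hq using Submodule.span_induction with
  | zero => exact zero_mem _
  | add x y _ _ hx hy => exact add_mem hx hy
  | mem x hx => exact Submodule.subset_span ⟨0, x, hx, by simp⟩
  | smul a x hxs hx =>
    clear hxs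
    induction hx using Submodule.span_induction with
    | zero => rw [smul_zero]; exact zero_mem _
    | add x y _ _ hx hy => rw [smul_add]; exact add_mem hx hy
    | smul c x _ hx => rw [smul_comm]; exact Submodule.smul_mem _ _ hx
    | mem x hx =>
      obtain ⟨u, p, hp, rfl⟩ := hx
      rw [smul_eq_mul]
      induction a using MvPolynomial.induction_on' with
      | add f g hf hg => rw [add_mul]; exact add_mem hf hg
      | monomial v c =>
        have : (monomial v c : MvPolynomial τ K) * (monomial u 1 * p) =
            c • (monomial (v + u) 1 * p) := by
          rw [← mul_assoc, monomial_mul, ← smul_mul_assoc, smul_monomial]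
          simp
        rw [this]
        exact Submodule.smul_mem _ _ (Submodule.subset_span ⟨v + u, p, hp, rfl⟩)

/-- A monomial multiple of a homogeneous generator is homogeneous, so its part of degree d is either
itself or zero. -/
lemma coeffsInDegree_mem_span {S : Set (MvPolynomial τ K)}
    (hS : ∀ p ∈ S, ∃ e, p.IsHomogeneous e) (d : ℕ) {q : MvPolynomial τ K}
    (hq : q ∈ Ideal.span S) :
    coeffsInDegree τ K d q ∈
      Submodule.span K (coeffsInDegree τ K d '' multiplesInDegree S d) := by
  have hx := mem_span_monomial_mul hq
  clear hq
  induction hx using Submodule.span_induction with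
  | zero => simp
  | add x y _ _ hx hy => rw [map_add]; exact add_mem hx hy
  | smul c x _ hx => rw [map_smul]; exact Submodule.smul_mem _ _ hx
  | mem x hx =>
    obtain ⟨u, p, hp, rfl⟩ := hx
    obtain ⟨e, he⟩ := hS p hp
    have hm : (monomial u (1 : K) * p).IsHomogeneous (u.degree + e) :=
      (isHomogeneous_monomial _ rfl).mul he
    by_cases h : u.degree + e = d
    · rw [h] at hm
      exact Submodule.subset_span ⟨_, ⟨u, p, hp, rfl, hm⟩, rfl⟩
    · rw [coeffsInDegree_eq_zero hm h]
      exact zero_mem _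

/-- Projective Nullstellensatz: if homogeneous polynomials have no common zero but the origin,
then in some degree their monomial multiples span all forms. -/
lemma exists_degree_span_eq_top [IsAlgClosed K] {S : Set (MvPolynomial τ K)}
    (hS : ∀ p ∈ S, ∃ e, p.IsHomogeneous e)
    (h : ∀ k : τ → K, (∀ p ∈ S, eval k p = 0) → k = 0) :
    ∃ d, Submodule.span K (coeffsInDegree τ K d '' multiplesInDegree S d) = ⊤ := by
  -- By the affine Nullstellensatz every variable lies in the radical, so some power of the ideal of
  -- variables lies in the ideal of `S`; the exponent is the required degree.
  have hrad : idealOfVars τ K ≤ (Ideal.span S).radical := by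
    rw [← vanishingIdeal_zeroLocus_eq_radical (K := K) (Ideal.span S), idealOfVars,
      Ideal.span_le]
    rintro _ ⟨i, rfl⟩
    rw [SetLike.mem_coe, mem_vanishingIdeal_iff]
    intro x hx
    have : x = 0 := h x fun p hp => hx p (Ideal.subset_span hp)
    simp [this]
  obtain ⟨d, hd⟩ := Ideal.exists_pow_le_of_le_radical_of_fg hrad (idealOfVars_fg τ K)
  refine ⟨d, ?_⟩
  rw [eq_top_iff, ← (Pi.basisFun K _).span_eq, Submodule.span_le]
  rintro _ ⟨m, rfl⟩
  have hm : (monomial m.1 1 : MvPolynomial τ K) ∈ Ideal.span S :=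
    hd ((monomial_mem_pow_idealOfVars_iff d m.1 one_ne_zero).2 m.2.ge)
  have heq : Pi.basisFun K {m : τ →₀ ℕ // m.degree = d} m =
      coeffsInDegree τ K d (monomial m.1 1) := by
    ext m'
    rw [coeffsInDegree_apply, coeff_monomial, Pi.basisFun_apply, Pi.single_apply]
    simp only [Subtype.ext_iff, eq_comm]
  rw [heq]
  exact coeffsInDegree_mem_span hS d hm

/-- Selecting a basis among the spanning multiples turns the absence of a common zero into a
nonvanishing determinant of coefficients, which can be computed over a coefficient ring and then
specialized. -/
lemma exists_det_ne_zero [IsAlgClosed K] {S : Set (MvPolynomial τ K)}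
    (hS : ∀ p ∈ S, ∃ e, p.IsHomogeneous e)
    (h : ∀ k : τ → K, (∀ p ∈ S, eval k p = 0) → k = 0) :
    ∃ d, ∃ f : {m : τ →₀ ℕ // m.degree = d} → MvPolynomial τ K,
      (∀ j, f j ∈ multiplesInDegree S d) ∧
      (Matrix.of fun i j => coeff (i : {m : τ →₀ ℕ // m.degree = d}).1 (f j)).det ≠ 0 := by
  obtain ⟨d, hd⟩ := exists_degree_span_eq_top hS h
  obtain ⟨b, hb1, hb2, hb3⟩ := exists_linearIndependent K
    (coeffsInDegree τ K d '' multiplesInDegree S d)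
  rw [hd] at hb2
  let B : Module.Basis b K _ := Module.Basis.mk hb3 (by rw [Subtype.range_coe, hb2])
  let e := B.indexEquiv (Pi.basisFun K {m : τ →₀ ℕ // m.degree = d})
  choose f hf hf2 using fun j => hb1 (e.symm j).2
  refine ⟨d, f, hf, ?_⟩
  have hli : LinearIndependent K (fun j => coeffsInDegree τ K d (f j)) := by
    simp only [hf2]
    exact hb3.comp _ e.symm.injective
  rw [← isUnit_iff_ne_zero, ← Matrix.isUnit_iff_isUnit_det,
    ← Matrix.linearIndependent_cols_iff_isUnit]
  exact hli

/-- An invertible coefficient matrix expresses each monomial of degree d, in particular each x_i ^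
d, through the f_j, which vanish at a common zero. -/
lemma eq_zero_of_det_ne_zero {S : Set (MvPolynomial τ K)} {d : ℕ}
    {f : {m : τ →₀ ℕ // m.degree = d} → MvPolynomial τ K}
    (hf : ∀ j, f j ∈ multiplesInDegree S d)
    (hdet : (Matrix.of fun i j => coeff (i : {m : τ →₀ ℕ // m.degree = d}).1 (f j)).det ≠ 0)
    (k : τ → K) (hk : ∀ p ∈ S, eval k p = 0) : k = 0 := by
  have hk' : ∀ j, eval k (f j) = 0 := by
    intro j
    obtain ⟨u, p, hp, he, -⟩ := hf j
    rw [he, map_mul, hk p hp, mul_zero]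
  set M : Matrix {m : τ →₀ ℕ // m.degree = d} {m : τ →₀ ℕ // m.degree = d} K :=
    Matrix.of fun i j => coeff i.1 (f j) with hM
  have hunit : IsUnit M.det := isUnit_iff_ne_zero.2 hdet
  have hmono : ∀ m : {m : τ →₀ ℕ // m.degree = d}, eval k (monomial m.1 (1 : K)) = 0 := by
    intro m
    have hexp : (monomial m.1 (1 : K)) = ∑ j, (M⁻¹ j m) • f j := by
      ext m'
      rw [coeff_sum]
      simp only [coeff_smul, smul_eq_mul]
      by_cases hm' : m'.degree = d
      · have h1 := congrFun (congrFun (Matrix.mul_nonsing_inv M hunit) ⟨m', hm'⟩) m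
        rw [Matrix.mul_apply, Matrix.one_apply] at h1
        rw [coeff_monomial]
        have h2 : (if m.1 = m' then (1 : K) else 0) =
            if (⟨m', hm'⟩ : {m : τ →₀ ℕ // m.degree = d}) = m then 1 else 0 := by
          simp only [Subtype.ext_iff, eq_comm]
        rw [h2, ← h1]
        exact Finset.sum_congr rfl fun j _ => mul_comm _ _
      · rw [coeff_monomial, if_neg (by rintro rfl; exact hm' m.2)]
        symm
        refine Finset.sum_eq_zero fun j _ => ?_
        obtain ⟨u, p, hp, he, hh⟩ := hf j
        rw [hh.coeff_eq_zero hm', mul_zero]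
    rw [hexp, map_sum]
    refine Finset.sum_eq_zero fun j _ => ?_
    rw [smul_eval, hk', mul_zero]
  ext i
  have := hmono ⟨Finsupp.single i d, by simp⟩
  rw [eval_monomial] at this
  simp only [one_mul, pow_zero, Finsupp.prod_single_index] at this
  exact (pow_eq_zero_iff (by rintro rfl; simp at this)).1 this

end Nullstellensatz

/-- Main theorem of elimination theory, over an arbitrary coefficient ring. -/
theorem elimination_of_homogeneous {A τ K : Type*} [CommRing A] [Fintype τ] [DecidableEq τ]
    [Field K] [IsAlgClosed K] (S : Set (MvPolynomial τ A))
    (hS : ∀ p ∈ S, ∃ e, p.IsHomogeneous e) :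
    ∃ S' : Set A, ∀ φ : A →+* K,
      (∃ k : τ → K, k ≠ 0 ∧ ∀ p ∈ S, eval₂ φ k p = 0) ↔ ∀ q ∈ S', φ q = 0 := by
  -- The eliminated equations are the maximal minors, in all degrees d, of the matrices whose
  -- columns are the monomial multiples of members of `S`.
  refine ⟨{q | ∃ d, ∃ f : {m : τ →₀ ℕ // m.degree = d} → MvPolynomial τ A,
    (∀ j, ∃ u : τ →₀ ℕ, ∃ p ∈ S, f j = monomial u 1 * p ∧ (f j).IsHomogeneous d) ∧
    q = (Matrix.of fun i j => coeff (i : {m : τ →₀ ℕ // m.degree = d}).1 (f j)).det},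
    fun φ => ?_⟩
  have hdet : ∀ d, ∀ f : {m : τ →₀ ℕ // m.degree = d} → MvPolynomial τ A,
      φ (Matrix.of fun i j => coeff (i : {m : τ →₀ ℕ // m.degree = d}).1 (f j)).det =
      (Matrix.of fun i j => coeff (i : {m : τ →₀ ℕ // m.degree = d}).1
        (map φ (f j))).det := by
    intro d f
    rw [RingHom.map_det]
    congr 1
  constructor
  · rintro ⟨k, hk0, hk⟩ q ⟨d, f, hf, rfl⟩
    by_contra hne
    rw [hdet] at hne
    refine hk0 (eq_zero_of_det_ne_zero (S := map φ '' S) (f := fun j => map φ (f j))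
      ?_ hne k ?_)
    · intro j
      obtain ⟨u, p, hp, he, hh⟩ := hf j
      exact ⟨u, map φ p, ⟨p, hp, rfl⟩, by simp [he], hh.map φ⟩
    · rintro _ ⟨p, hp, rfl⟩
      rw [eval_map]
      exact hk p hp
  · intro h
    by_contra hcon
    push Not at hcon
    obtain ⟨d, f, hf, hne⟩ := exists_det_ne_zero (S := map φ '' S)
      (by rintro _ ⟨p, hp, rfl⟩; obtain ⟨e, he⟩ := hS p hp; exact ⟨e, he.map φ⟩)
      (by
        intro k hk
        by_contra hk0
        obtain ⟨p, hp, hne⟩ := hcon k hk0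
        refine hne ?_
        rw [← eval_map]
        exact hk _ ⟨p, hp, rfl⟩)
    have hf' : ∀ j, ∃ g : MvPolynomial τ A, map φ g = f j ∧
        ∃ u : τ →₀ ℕ, ∃ p ∈ S, g = monomial u 1 * p ∧ g.IsHomogeneous d := by
      intro j
      obtain ⟨u, _, ⟨p, hp, rfl⟩, he, hh⟩ := hf j
      obtain ⟨e, hpe⟩ := hS p hp
      by_cases hde : u.degree + e = d
      · exact ⟨monomial u 1 * p, by simp [he], u, p, hp, rfl,
          hde ▸ (isHomogeneous_monomial _ rfl).mul hpe⟩
      -- The degree of a member of `S` over `A` need not be the d of its image, but then the image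
      -- is homogeneous of two degrees, hence zero, and the determinant has a zero column.
      · exfalso
        have hh2 : (f j).IsHomogeneous (u.degree + e) := by
          rw [he]
          exact (isHomogeneous_monomial _ rfl).mul (hpe.map φ)
        refine hne (Matrix.det_eq_zero_of_column_eq_zero j fun i => ?_)
        refine hh2.coeff_eq_zero ?_
        rw [i.2]
        exact Ne.symm hde
    choose g hg hg2 using hf'
    refine hne ?_
    have := h _ ⟨d, g, hg2, rfl⟩
    rw [hdet] at this
    simpa only [hg] using this

lemma eval₂_smul_of_isHomogeneous {A τ K : Type*} [CommRing A] [Field K] (φ : A →+* K)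
    {p : MvPolynomial τ A} {d : ℕ} (hp : p.IsHomogeneous d) (t : K) (k : τ → K) :
    eval₂ φ (t • k) p = t ^ d * eval₂ φ k p := by
  rw [eval₂_eq, eval₂_eq, Finset.mul_sum]
  refine Finset.sum_congr rfl fun m hm => ?_
  have hd : m.degree = d := by
    by_contra hne
    exact mem_support_iff.1 hm (hp.coeff_eq_zero hne)
  simp only [Pi.smul_apply, smul_eq_mul, mul_pow, Finset.prod_mul_distrib, Finset.prod_pow_eq_pow_sum]
  rw [show ∑ i ∈ m.support, m i = d from hd]
  ring

/-- If the zero set of a polynomial over an infinite field is invariant under scaling, so is that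
of its homogeneous components. -/
lemma eval₂_homogeneousComponent_eq_zero {A τ K : Type*} [CommRing A] [Field K] [Infinite K]
    (φ : A →+* K) (p : MvPolynomial τ A) (k : τ → K)
    (h : ∀ t : K, t ≠ 0 → eval₂ φ (t • k) p = 0) (d : ℕ) :
    eval₂ φ k (homogeneousComponent d p) = 0 := by
  -- As a polynomial in t, the value at t • k has the values of the homogeneous components at k as
  -- coefficients, and it vanishes at infinitely many t.
  let q : Polynomial K := ∑ i ∈ Finset.range (p.totalDegree + 1),
    Polynomial.C (eval₂ φ k (homogeneousComponent i p)) * Polynomial.X ^ i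
  have hq : ∀ t : K, q.eval t = eval₂ φ (t • k) p := by
    intro t
    conv_rhs => rw [← sum_homogeneousComponent p]
    rw [← coe_eval₂Hom, map_sum, Polynomial.eval_finsetSum]
    refine Finset.sum_congr rfl fun i _ => ?_
    rw [coe_eval₂Hom, eval₂_smul_of_isHomogeneous φ (homogeneousComponent_isHomogeneous i p)]
    rw [Polynomial.eval_mul, Polynomial.eval_C, Polynomial.eval_pow, Polynomial.eval_X, mul_comm]
  have hq0 : q = 0 := by
    refine Polynomial.eq_zero_of_infinite_isRoot q (Set.Infinite.mono
      (s := {t : K | t ≠ 0}) (fun t ht => ?_) ?_)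
    · exact (hq t).trans (h t ht)
    · exact (Set.finite_singleton (0 : K)).infinite_compl
  by_cases hd : d < p.totalDegree + 1
  · have := congrArg (fun r => Polynomial.coeff r d) hq0
    simp only [q, Polynomial.finsetSum_coeff, Polynomial.coeff_C_mul_X_pow,
      Polynomial.coeff_zero] at this
    rw [Finset.sum_ite_eq] at this
    rwa [if_pos (Finset.mem_range.2 hd)] at this
  · rw [homogeneousComponent_eq_zero _ _ (by omega), eval₂_zero]

/-- A set of polynomials whose zero locus is invariant under scaling has the same zero locus as
the set of homogeneous components. -/
lemma forall_homogeneousComponent_iff {A τ K : Type*} [CommRing A] [Field K] [Infinite K]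
    (S : Set (MvPolynomial τ A)) (φ : A →+* K)
    (hS : ∀ (k : τ → K) (t : K), t ≠ 0 → (∀ p ∈ S, eval₂ φ k p = 0) →
      ∀ p ∈ S, eval₂ φ (t • k) p = 0) (k : τ → K) :
    (∀ p ∈ S, eval₂ φ k p = 0) ↔
      ∀ q ∈ {q | ∃ p ∈ S, ∃ d, q = homogeneousComponent d p}, eval₂ φ k q = 0 := by
  constructor
  · rintro h _ ⟨p, hp, d, rfl⟩
    exact eval₂_homogeneousComponent_eq_zero φ p k (fun t ht => hS k t ht h p hp) d
  · intro h p hp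
    rw [← sum_homogeneousComponent p, ← coe_eval₂Hom, map_sum]
    exact Finset.sum_eq_zero fun i _ => h _ ⟨p, hp, i, rfl⟩

end Elimination

/-! ### A calculus of Zariski closed conditions on affine space. -/

noncomputable section AlgebraicPredicates

/-- Polynomial functions on affine space. -/
def IsPolyFun {σ : Type*} (f : (σ → ℂ) → ℂ) : Prop :=
  ∃ p : MvPolynomial σ ℂ, ∀ x, f x = eval x p

/-- Predicates on affine space that cut out Zariski closed subsets. -/
def AlgPred {σ : Type*} (P : (σ → ℂ) → Prop) : Prop :=
  ∃ S : Set (MvPolynomial σ ℂ), ∀ x, P x ↔ ∀ p ∈ S, eval x p = 0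

namespace IsPolyFun

variable {σ ρ : Type*} {f g : (σ → ℂ) → ℂ}

lemma const (c : ℂ) : IsPolyFun fun _ : σ → ℂ => c := ⟨C c, fun x => by simp⟩

lemma coord (i : σ) : IsPolyFun fun x : σ → ℂ => x i := ⟨X i, fun x => by simp⟩

lemma mul (hf : IsPolyFun f) (hg : IsPolyFun g) : IsPolyFun fun x => f x * g x := by
  obtain ⟨p, hp⟩ := hf
  obtain ⟨q, hq⟩ := hg
  exact ⟨p * q, fun x => by simp [hp, hq]⟩

lemma sum {κ : Type*} {s : Finset κ} {f : κ → (σ → ℂ) → ℂ} (hf : ∀ i, IsPolyFun (f i)) :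
    IsPolyFun fun x => ∑ i ∈ s, f i x := by
  choose p hp using hf
  exact ⟨∑ i ∈ s, p i, fun x => by simp [hp]⟩

lemma comp (hf : IsPolyFun f) {h : (ρ → ℂ) → σ → ℂ} (hh : ∀ i, IsPolyFun fun x => h x i) :
    IsPolyFun fun x => f (h x) := by
  obtain ⟨p, hp⟩ := hf
  choose q hq using hh
  refine ⟨bind₁ q p, fun x => ?_⟩
  have hx : h x = fun i => eval x (q i) := funext fun i => hq i x
  change f (h x) = _
  rw [hp, hx, ← coe_aeval_eq_eval, ← coe_aeval_eq_eval, RingHom.coe_coe, RingHom.coe_coe,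
    aeval_bind₁]

lemma eval_fixed (p : MvPolynomial σ ℂ) {h : (ρ → ℂ) → σ → ℂ}
    (hh : ∀ i, IsPolyFun fun x => h x i) : IsPolyFun fun x => eval (h x) p :=
  comp ⟨p, fun _ => rfl⟩ hh

end IsPolyFun

namespace AlgPred

variable {σ : Type*} {P Q : (σ → ℂ) → Prop}

lemma congr (h : AlgPred P) (hPQ : ∀ x, Q x ↔ P x) : AlgPred Q := by
  obtain ⟨S, hS⟩ := h
  exact ⟨S, fun x => (hPQ x).trans (hS x)⟩

lemma of_eq_zero {f : (σ → ℂ) → ℂ} (hf : IsPolyFun f) : AlgPred fun x => f x = 0 := by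
  obtain ⟨p, hp⟩ := hf
  exact ⟨{p}, fun x => by simp [hp]⟩

lemma all {κ : Sort*} {P : κ → (σ → ℂ) → Prop} (h : ∀ i, AlgPred (P i)) :
    AlgPred fun x => ∀ i, P i x := by
  choose S hS using h
  refine ⟨⋃ i, S i, fun x => ?_⟩
  simp only [hS, Set.mem_iUnion, forall_exists_index]
  exact forall_comm

lemma and (hP : AlgPred P) (hQ : AlgPred Q) : AlgPred fun x => P x ∧ Q x := by
  obtain ⟨S, hS⟩ := hP
  obtain ⟨T, hT⟩ := hQ
  refine ⟨S ∪ T, fun x => ?_⟩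
  simp only [hS, hT, Set.mem_union, or_imp, forall_and]

/-- Elimination of a vector that ranges over the nonzero vectors up to scaling. -/
lemma exists_ne_zero {τ : Type*} [Fintype τ] [DecidableEq τ] {P : (σ → ℂ) → (τ → ℂ) → Prop}
    (h : AlgPred fun z : σ ⊕ τ → ℂ => P (z ∘ Sum.inl) (z ∘ Sum.inr))
    (hs : ∀ x k (t : ℂ), t ≠ 0 → P x k → P x (t • k)) :
    AlgPred fun x => ∃ k, k ≠ 0 ∧ P x k := by
  obtain ⟨S, hS⟩ := h
  -- The parameters become coefficients, so that `elimination_of_homogeneous` applies to the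
  -- variables indexed by `τ`.
  let toIter : MvPolynomial (σ ⊕ τ) ℂ →ₐ[ℂ] MvPolynomial τ (MvPolynomial σ ℂ) :=
    aeval (Sum.elim (fun s => C (X s)) X)
  have hiter : ∀ (x : σ → ℂ) (k : τ → ℂ) p,
      eval₂ (eval x) k (toIter p) = eval (Sum.elim x k) p := by
    intro x k p
    induction p using MvPolynomial.induction_on with
    | C a =>
      rw [← algebraMap_eq, AlgHom.commutes, IsScalarTower.algebraMap_apply ℂ (MvPolynomial σ ℂ)]
      simp [algebraMap_eq]
    | add p q hp hq => rw [map_add, eval₂_add, hp, hq, map_add]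
    | mul_X p i hp =>
      rw [map_mul, eval₂_mul, hp, map_mul]
      rcases i with i | i <;> simp [toIter]
  have hP : ∀ x k, P x k ↔ ∀ q ∈ toIter '' S, eval₂ (eval x) k q = 0 := by
    intro x k
    have := hS (Sum.elim x k)
    simp only [Sum.elim_comp_inl, Sum.elim_comp_inr] at this
    rw [this]
    simp [hiter]
  -- The equations need not be homogeneous in k; since their zero set is a cone in k, they may be
  -- replaced by their homogeneous components.
  obtain ⟨S', hS'⟩ := elimination_of_homogeneous (K := ℂ)
    {q | ∃ p ∈ toIter '' S, ∃ d, q = homogeneousComponent d p}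
    (by rintro _ ⟨p, -, d, rfl⟩; exact ⟨d, homogeneousComponent_isHomogeneous d p⟩)
  refine ⟨S', fun x => ?_⟩
  rw [← hS']
  refine exists_congr fun k => and_congr_right fun _ => ?_
  rw [hP]
  refine forall_homogeneousComponent_iff _ _ (fun k t ht hk => ?_) k
  rw [← hP] at hk ⊢
  exact hs x k t ht hk

/-- Linear dependence is a closed condition. -/
lemma not_linearIndependent {κ μ : Type*} [Fintype κ] [DecidableEq κ]
    {f : κ → μ → (σ → ℂ) → ℂ} (hf : ∀ i j, IsPolyFun (f i j)) :
    AlgPred fun x => ¬ LinearIndependent ℂ fun i j => f i j x := by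
  have : AlgPred fun x => ∃ g : κ → ℂ, g ≠ 0 ∧ ∀ j, ∑ i, g i * f i j x = 0 := by
    refine exists_ne_zero (P := fun x g => ∀ j, ∑ i, g i * f i j x = 0) ?_ ?_
    · refine all fun j => of_eq_zero (IsPolyFun.sum fun i => ?_)
      exact (IsPolyFun.coord (Sum.inr i)).mul ((hf i j).comp fun s => IsPolyFun.coord (Sum.inl s))
    · intro x k t _ h j
      simp only [Pi.smul_apply, smul_eq_mul, mul_assoc, ← Finset.mul_sum, h j, mul_zero]
  refine this.congr fun x => ?_
  rw [Fintype.linearIndependent_iff]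
  push Not
  refine exists_congr fun g => ?_
  rw [and_comm, ← Function.ne_iff]
  refine and_congr Iff.rfl ?_
  rw [funext_iff]
  simp [Finset.sum_apply]

/-- A closed cone is cut out by homogeneous polynomials. -/
lemma exists_homogeneous (hP : AlgPred P) (hs : ∀ x (t : ℂ), t ≠ 0 → P x → P (t • x)) :
    ∃ S : Set (MvPolynomial σ ℂ), (∀ p ∈ S, ∃ d, p.IsHomogeneous d) ∧
      ∀ x, P x ↔ ∀ p ∈ S, eval x p = 0 := by
  obtain ⟨S, hS⟩ := hP
  refine ⟨{q | ∃ p ∈ S, ∃ d, q = homogeneousComponent d p}, ?_, fun x => ?_⟩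
  · rintro _ ⟨p, -, d, rfl⟩
    exact ⟨d, homogeneousComponent_isHomogeneous d p⟩
  · rw [hS]
    refine forall_homogeneousComponent_iff S (RingHom.id ℂ) (fun k t ht hk => ?_) x
    have := hs k t ht ((hS k).2 hk)
    exact (hS _).1 this

end AlgPred

end AlgebraicPredicates

/-! ### Flags annihilated by a trilinear form, as a closed condition. -/

noncomputable section Flags

open Module Submodule

section LinearAlgebra

variable {K V W : Type*} [Field K] [AddCommGroup V] [Module K V] [FiniteDimensional K V]
  [AddCommGroup W] [Module K W] [FiniteDimensional K W]

lemma exists_ne_zero_mem_of_finrank_lt (U : Submodule K V) (f : V →ₗ[K] W)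
    (h : finrank K W < finrank K U) : ∃ v ∈ U, v ≠ 0 ∧ f v = 0 := by
  have hk := LinearMap.ker_ne_bot_of_finrank_lt (f := f.domRestrict U) h
  obtain ⟨v, hv, hv0⟩ := Submodule.exists_mem_ne_zero_of_ne_bot hk
  exact ⟨v.1, v.2, fun h => hv0 (Subtype.ext h), hv⟩

lemma exists_between_finrank_eq {M N : Submodule K V} (hMN : M ≤ N) {k : ℕ}
    (h1 : finrank K M ≤ k) (h2 : k ≤ finrank K N) :
    ∃ U : Submodule K V, M ≤ U ∧ U ≤ N ∧ finrank K U = k := by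
  induction k, h1 using Nat.le_induction with
  | base => exact ⟨M, le_rfl, hMN, rfl⟩
  | succ k hk ih =>
    obtain ⟨U, hMU, hUN, hU⟩ := ih (by omega)
    have hlt : U < N := lt_of_le_of_ne hUN (by rintro rfl; omega)
    obtain ⟨x, hxN, hxU⟩ := SetLike.exists_of_lt hlt
    refine ⟨U ⊔ K ∙ x, hMU.trans le_sup_left, sup_le hUN (by simpa using hxN), ?_⟩
    have hlt2 : U < U ⊔ K ∙ x := lt_of_le_of_ne le_sup_left fun h => hxU (by
      rw [h]; exact mem_sup_right (mem_span_singleton_self x))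
    have e1 := Submodule.finrank_lt_finrank_of_lt hlt2
    have e2 := Submodule.finrank_add_le_finrank_add_finrank U (K ∙ x)
    have e3 := finrank_span_le_card (R := K) ({x} : Set V)
    simp at e3
    omega

/-- This form of the rank bound consists of linear dependencies only, each of them a closed
condition. -/
lemma finrank_span_range_le_iff {κ : Type*} (v : κ → V) (r : ℕ) :
    finrank K (span K (Set.range v)) ≤ r ↔
      ∀ g : Fin (r + 1) → κ, ¬ LinearIndependent K fun i => v (g i) := by
  constructor
  · intro h g hg
    have e1 := finrank_span_eq_card hg
    have e2 : finrank K (span K (Set.range fun i => v (g i))) ≤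
        finrank K (span K (Set.range v)) :=
      Submodule.finrank_mono (span_mono (by rintro _ ⟨i, rfl⟩; exact ⟨g i, rfl⟩))
    simp at e1
    omega
  · intro h
    by_contra hlt
    push Not at hlt
    obtain ⟨f, hf, -, hli⟩ := exists_fun_fin_finrank_span_eq K (Set.range v)
    choose g hg using hf
    refine h (fun i => g (Fin.castLE hlt i)) ?_
    simp only [hg]
    exact hli.comp _ (Fin.castLE_injective hlt)

end LinearAlgebra

variable {ι : Type*} [Fintype ι] [DecidableEq ι]

/-- Trilinear forms on `ℂ^ι`. -/
abbrev Trilinear (ι : Type*) : Type _ := (ι → ℂ) →ₗ[ℂ] (ι → ℂ) →ₗ[ℂ] (ι → ℂ) →ₗ[ℂ] ℂ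

/-- There is a flag `L ≤ M ≤ W` of subspaces of dimension two, dimension three and codimension two
with `T(L, M, W) = 0`. -/
def HasTripleFlag (T : Trilinear ι) : Prop :=
  ∃ L M W : Submodule ℂ (ι → ℂ), L ≤ M ∧ M ≤ W ∧ finrank ℂ L = 2 ∧ finrank ℂ M = 3 ∧
    finrank ℂ ((ι → ℂ) ⧸ W) = 2 ∧ ∀ l ∈ L, ∀ m ∈ M, ∀ w ∈ W, T l m w = 0

/-- The form `T` vanishes on `L × M × M`, and the linear forms `T(l, m, ·)` span a space of
dimension at most two. -/
def FlagCond (T : Trilinear ι) (L M : Submodule ℂ (ι → ℂ)) : Prop :=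
  (∀ l ∈ L, ∀ m ∈ M, ∀ m' ∈ M, T l m m' = 0) ∧ finrank ℂ (map₂ T L M) ≤ 2

/-- No dimensions enter `FlagCond`, so vectors of L and M inherit it even when they are linearly
dependent. -/
lemma FlagCond.mono {T : Trilinear ι} {L M L' M' : Submodule ℂ (ι → ℂ)} (h : FlagCond T L M)
    (hL : L' ≤ L) (hM : M' ≤ M) : FlagCond T L' M' :=
  ⟨fun l hl m hm m' hm' => h.1 l (hL hl) m (hM hm) m' (hM hm'),
    (Submodule.finrank_mono (map₂_le_map₂ hL hM)).trans h.2⟩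

/-- Eliminates W: it has to lie between M and the common kernel of the forms T(l, m, ·), and a space
of codimension two fits there when these forms vanish on M and span at most two dimensions. The
bound on the number of coordinates gives 3 ≤ dim W. -/
lemma hasTripleFlag_iff_flagCond (hι : 5 ≤ Fintype.card ι) (T : Trilinear ι) :
    HasTripleFlag T ↔ ∃ L M : Submodule ℂ (ι → ℂ), L ≤ M ∧ finrank ℂ L = 2 ∧ finrank ℂ M = 3 ∧
      FlagCond T L M := by
  have hV : finrank ℂ (ι → ℂ) = Fintype.card ι := finrank_pi ℂ
  constructor
  · rintro ⟨L, M, W, hLM, hMW, hL, hM, hW, h⟩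
    refine ⟨L, M, hLM, hL, hM, fun l hl m hm m' hm' => h l hl m hm m' (hMW hm'), ?_⟩
    have hle : map₂ T L M ≤ W.dualAnnihilator := by
      rw [map₂_le]
      intro l hl m hm
      rw [mem_dualAnnihilator]
      exact h l hl m hm
    refine (Submodule.finrank_mono hle).trans ?_
    rw [← (dualQuotEquivDualAnnihilator W).finrank_eq, Subspace.dual_finrank_eq, hW]
  · rintro ⟨L, M, hLM, hL, hM, h1, h2⟩
    have hMN : M ≤ (map₂ T L M).dualCoannihilator := by
      intro m' hm'
      rw [mem_dualCoannihilator]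
      intro φ hφ
      have hle : map₂ T L M ≤ M.dualAnnihilator := by
        rw [map₂_le]
        intro l hl m hm
        rw [mem_dualAnnihilator]
        exact h1 l hl m hm
      exact (mem_dualAnnihilator _).1 (hle hφ) m' hm'
    have e : finrank ℂ (map₂ T L M) + finrank ℂ (map₂ T L M).dualCoannihilator =
        Fintype.card ι := by
      rw [← hV]
      exact Subspace.finrank_add_finrank_dualCoannihilator_eq (map₂ T L M)
    obtain ⟨W, hMW, hWN, hW⟩ := exists_between_finrank_eq hMN (k := Fintype.card ι - 2)
      (by omega) (by omega)
    have e2 := finrank_quotient_add_finrank W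
    refine ⟨L, M, W, hLM, hMW, hL, hM, by omega, fun l hl m hm w hw => ?_⟩
    exact (mem_dualCoannihilator _).1 (hWN hw) _ (apply_mem_map₂ T hl hm)

/-- The line spanned by two vectors and the plane spanned by three, with their condition. -/
def VectorCond (T : Trilinear ι) (b₀ b₁ v : ι → ℂ) : Prop :=
  FlagCond T ((ℂ ∙ b₀) ⊔ (ℂ ∙ b₁)) ((ℂ ∙ b₀) ⊔ (ℂ ∙ b₁) ⊔ (ℂ ∙ v))

lemma span_range_pair (a b : ι → ℂ) : span ℂ (Set.range ![a, b]) = (ℂ ∙ a) ⊔ (ℂ ∙ b) := by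
  rw [Matrix.range_cons_cons_empty, span_insert]

lemma span_range_triple (a b c : ι → ℂ) :
    span ℂ (Set.range ![a, b, c]) = (ℂ ∙ a) ⊔ (ℂ ∙ b) ⊔ (ℂ ∙ c) := by
  rw [Matrix.range_cons, Matrix.range_cons_cons_empty, Set.singleton_union, span_insert,
    span_insert, sup_assoc]

/-- The quantified form of the flag condition in which each vector varies in a fixed linear
subspace, up to scaling. -/
lemma hasTripleFlag_iff_vectors (hι : 5 ≤ Fintype.card ι) (T : Trilinear ι) :
    HasTripleFlag T ↔ ∃ b₀ : ι → ℂ, b₀ ≠ 0 ∧ ∀ i, ∃ b₁ : ι → ℂ, b₁ ≠ 0 ∧ (b₁ i = 0 ∧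
      ∀ j k, ∃ v : ι → ℂ, v ≠ 0 ∧ (v j = 0 ∧ v k = 0 ∧ VectorCond T b₀ b₁ v)) := by
  rw [hasTripleFlag_iff_flagCond hι]
  constructor
  -- A plane L meets every hyperplane b₁ i = 0, and a three-dimensional M meets every v j = v k = 0.
  -- For some indices the vectors obtained are dependent, which does no harm.
  · rintro ⟨L, M, hLM, hL, hM, h⟩
    obtain ⟨b₀, hb₀, h0, -⟩ := exists_ne_zero_mem_of_finrank_lt L (0 : (ι → ℂ) →ₗ[ℂ] ℂ)
      (by rw [finrank_self]; omega)
    refine ⟨b₀, h0, fun i => ?_⟩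
    obtain ⟨b₁, hb₁, h1, hi⟩ := exists_ne_zero_mem_of_finrank_lt L
      (LinearMap.proj i : (ι → ℂ) →ₗ[ℂ] ℂ) (by rw [finrank_self]; omega)
    refine ⟨b₁, h1, hi, fun j k => ?_⟩
    obtain ⟨v, hv, h2, hjk⟩ := exists_ne_zero_mem_of_finrank_lt M
      ((LinearMap.proj j : (ι → ℂ) →ₗ[ℂ] ℂ).prod (LinearMap.proj k : (ι → ℂ) →ₗ[ℂ] ℂ))
      (by rw [finrank_prod, finrank_self]; omega)
    obtain ⟨hj, hk⟩ := Prod.ext_iff.1 hjk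
    have hL' : (ℂ ∙ b₀) ⊔ (ℂ ∙ b₁) ≤ L := sup_le (by simpa using hb₀) (by simpa using hb₁)
    exact ⟨v, h2, hj, hk, h.mono hL' (sup_le (hL'.trans hLM) (by simpa using hv))⟩
  -- Independence is an open condition and cannot be imposed directly. Instead i is chosen with b₀ i
  -- ≠ 0 and j with b₁ j ≠ 0; the prescribed zeros make the three vectors triangular, hence
  -- independent.
  · rintro ⟨b₀, h0, h⟩
    obtain ⟨i, hi⟩ := Function.ne_iff.1 h0
    obtain ⟨b₁, h1, h1i, h⟩ := h i
    obtain ⟨j, hj⟩ := Function.ne_iff.1 h1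
    obtain ⟨v, h2, h2i, h2j, h⟩ := h i j
    obtain ⟨k, hk⟩ := Function.ne_iff.1 h2
    have hli : LinearIndependent ℂ ![b₀, b₁, v] := by
      rw [Fintype.linearIndependent_iff]
      intro g hg
      simp only [Fin.sum_univ_three, Matrix.cons_val_zero, Matrix.cons_val_one,
        Matrix.cons_val] at hg
      have e1 := congrFun hg i
      simp only [Pi.add_apply, Pi.smul_apply, smul_eq_mul, h1i, h2i, Pi.zero_apply, mul_zero,
        add_zero] at e1
      have g0 : g 0 = 0 := (mul_eq_zero.1 e1).resolve_right hi
      have e2 := congrFun hg j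
      simp only [Pi.add_apply, Pi.smul_apply, smul_eq_mul, g0, h2j, Pi.zero_apply, mul_zero,
        add_zero, zero_mul, zero_add] at e2
      have g1 : g 1 = 0 := (mul_eq_zero.1 e2).resolve_right hj
      have e3 := congrFun hg k
      simp only [Pi.add_apply, Pi.smul_apply, smul_eq_mul, g0, g1, Pi.zero_apply,
        zero_mul, zero_add] at e3
      have g2 : g 2 = 0 := (mul_eq_zero.1 e3).resolve_right hk
      intro i
      fin_cases i
      exacts [g0, g1, g2]
    have hli2 : LinearIndependent ℂ ![b₀, b₁] := by
      have := hli.comp ![0, 1] (by decide)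
      convert this using 1
      ext a
      fin_cases a <;> rfl
    refine ⟨_, _, le_sup_left, ?_, ?_, h⟩
    · rw [← span_range_pair, finrank_span_eq_card hli2, Fintype.card_fin]
    · rw [← span_range_triple, finrank_span_eq_card hli, Fintype.card_fin]

/-- Multilinearity reduces everything to the generators: finitely many polynomial equations, and the
dependency of any three of the six covectors T(l, m, ·). -/
lemma vectorCond_iff (T : Trilinear ι) (b₀ b₁ v : ι → ℂ) :
    VectorCond T b₀ b₁ v ↔
      (∀ a b c, T (![b₀, b₁] a) (![b₀, b₁, v] b) (![b₀, b₁, v] c) = 0) ∧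
      ∀ g : Fin 3 → Fin 2 × Fin 3, ¬ LinearIndependent ℂ fun i j =>
        T (![b₀, b₁] (g i).1) (![b₀, b₁, v] (g i).2) (Pi.single j 1) := by
  rw [VectorCond, ← span_range_triple, ← span_range_pair, FlagCond]
  refine and_congr ⟨fun h a b c => h _ (subset_span ⟨a, rfl⟩) _ (subset_span ⟨b, rfl⟩) _
    (subset_span ⟨c, rfl⟩), fun h l hl m hm m' hm' => ?_⟩ ?_
  · induction hl using span_induction with
    | zero => simp
    | add x y _ _ hx hy => simp [hx, hy]
    | smul c x _ hx => simp [hx]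
    | mem x hx =>
      obtain ⟨a, rfl⟩ := hx
      induction hm using span_induction with
      | zero => simp
      | add x y _ _ hx hy => simp [hx, hy]
      | smul c x _ hx => simp [hx]
      | mem x hx =>
        obtain ⟨b, rfl⟩ := hx
        induction hm' using span_induction with
        | zero => simp
        | add x y _ _ hx hy => simp [hx, hy]
        | smul c x _ hx => simp [hx]
        | mem x hx =>
          obtain ⟨c, rfl⟩ := hx
          exact h a b c
  · have hset : Set.image2 (fun m n => T m n) (Set.range ![b₀, b₁]) (Set.range ![b₀, b₁, v]) =
        Set.range fun p : Fin 2 × Fin 3 => T (![b₀, b₁] p.1) (![b₀, b₁, v] p.2) := by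
      rw [Set.image2_range]
    rw [map₂_span_span, hset, finrank_span_range_le_iff]
    refine forall_congr' fun g => not_congr ?_
    -- A covector is replaced by its values on the standard basis; injectivity preserves linear
    -- independence.
    let e : ((ι → ℂ) →ₗ[ℂ] ℂ) →ₗ[ℂ] (ι → ℂ) :=
      LinearMap.pi fun j => LinearMap.applyₗ (Pi.single j 1)
    have he : LinearMap.ker e = ⊥ := by
      rw [LinearMap.ker_eq_bot']
      intro φ hφ
      refine LinearMap.pi_ext' fun j => LinearMap.ext_ring ?_
      exact congrFun hφ j
    exact (LinearMap.linearIndependent_iff e he).symm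

lemma VectorCond.smul {T : Trilinear ι} {b₀ b₁ v : ι → ℂ} (h : VectorCond T b₀ b₁ v)
    {r s t : ℂ} (hr : r ≠ 0) (hs : s ≠ 0) (ht : t ≠ 0) :
    VectorCond T (r • b₀) (s • b₁) (t • v) := by
  rw [VectorCond, span_singleton_smul_eq hr.isUnit, span_singleton_smul_eq hs.isUnit,
    span_singleton_smul_eq ht.isUnit]
  exact h

lemma isPolyFun_trilinearOf {σ : Type*} {t : ι → ι → ι → (σ → ℂ) → ℂ}
    (ht : ∀ i j k, IsPolyFun (t i j k)) {u v w : (σ → ℂ) → ι → ℂ}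
    (hu : ∀ i, IsPolyFun fun x => u x i) (hv : ∀ i, IsPolyFun fun x => v x i)
    (hw : ∀ i, IsPolyFun fun x => w x i) :
    IsPolyFun fun x => trilinearOf (fun i j k => t i j k x) (u x) (v x) (w x) := by
  simp only [trilinearOf_apply]
  exact .sum fun i => .sum fun j => .sum fun k => (ht i j k).mul ((hu i).mul ((hv j).mul (hw k)))

/-- Having a triple flag is a closed condition on trilinear forms. -/
lemma algPred_hasTripleFlag (hι : 5 ≤ Fintype.card ι) {σ : Type*} {t : ι → ι → ι → (σ → ℂ) → ℂ}
    (ht : ∀ i j k, IsPolyFun (t i j k)) :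
    AlgPred fun x => HasTripleFlag (trilinearOf fun i j k => t i j k x) := by
  -- Three nested eliminations, of b₀, b₁ and v; each needs invariance under rescaling of its
  -- vector, which is `VectorCond.smul`.
  refine AlgPred.congr ?_ fun x => hasTripleFlag_iff_vectors hι _
  refine AlgPred.exists_ne_zero (P := fun x b₀ => ∀ i, ∃ b₁ : ι → ℂ, b₁ ≠ 0 ∧ (b₁ i = 0 ∧
      ∀ j k, ∃ v : ι → ℂ, v ≠ 0 ∧ (v j = 0 ∧ v k = 0 ∧
        VectorCond (trilinearOf fun i j k => t i j k x) b₀ b₁ v))) ?_ ?_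
  · refine AlgPred.all fun i => AlgPred.exists_ne_zero (P := fun (z : σ ⊕ ι → ℂ) b₁ =>
      b₁ i = 0 ∧ ∀ j k, ∃ v : ι → ℂ, v ≠ 0 ∧ (v j = 0 ∧ v k = 0 ∧
        VectorCond (trilinearOf fun i j k => t i j k (z ∘ Sum.inl)) (z ∘ Sum.inr) b₁ v)) ?_ ?_
    · refine .and (.of_eq_zero (.coord (Sum.inr i))) (.all fun j => .all fun k => ?_)
      refine AlgPred.exists_ne_zero (P := fun (z : (σ ⊕ ι) ⊕ ι → ℂ) v => v j = 0 ∧ v k = 0 ∧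
        VectorCond (trilinearOf fun i j k => t i j k ((z ∘ Sum.inl) ∘ Sum.inl))
          ((z ∘ Sum.inl) ∘ Sum.inr) (z ∘ Sum.inr) v) ?_ ?_
      · refine .and (.of_eq_zero (.coord (Sum.inr j))) (.and (.of_eq_zero (.coord (Sum.inr k))) ?_)
        simp only [vectorCond_iff]
        have ht' : ∀ i j k, IsPolyFun fun z : ((σ ⊕ ι) ⊕ ι) ⊕ ι → ℂ =>
            t i j k (((z ∘ Sum.inl) ∘ Sum.inl) ∘ Sum.inl) := fun i j k =>
          (ht i j k).comp fun s => .coord _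
        have h2 : ∀ (a : Fin 2) (c : ι), IsPolyFun fun z : ((σ ⊕ ι) ⊕ ι) ⊕ ι → ℂ =>
            ![((z ∘ Sum.inl) ∘ Sum.inl) ∘ Sum.inr, (z ∘ Sum.inl) ∘ Sum.inr] a c := by
          intro a c
          fin_cases a
          exacts [.coord _, .coord _]
        have h3 : ∀ (a : Fin 3) (c : ι), IsPolyFun fun z : ((σ ⊕ ι) ⊕ ι) ⊕ ι → ℂ =>
            ![((z ∘ Sum.inl) ∘ Sum.inl) ∘ Sum.inr, (z ∘ Sum.inl) ∘ Sum.inr, z ∘ Sum.inr] a c := by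
          intro a c
          fin_cases a
          exacts [.coord _, .coord _, .coord _]
        refine .and (.all fun a => .all fun b => .all fun c => .of_eq_zero ?_) (.all fun g => ?_)
        · exact isPolyFun_trilinearOf ht' (h2 a) (h3 b) (h3 c)
        · exact .not_linearIndependent fun i j =>
            isPolyFun_trilinearOf ht' (h2 _) (h3 _) fun _ => .const _
      · rintro z v s hs ⟨hj, hk, h⟩
        refine ⟨by simp [hj], by simp [hk], ?_⟩
        simpa using h.smul one_ne_zero one_ne_zero hs
    · rintro z b₁ s hs ⟨hi, h⟩
      refine ⟨by simp [hi], fun j k => ?_⟩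
      obtain ⟨v, hv, hj, hk, h⟩ := h j k
      exact ⟨v, hv, hj, hk, by simpa using h.smul one_ne_zero hs one_ne_zero⟩
  · intro x b₀ s hs h i
    obtain ⟨b₁, h1, hi, h⟩ := h i
    refine ⟨b₁, h1, hi, fun j k => ?_⟩
    obtain ⟨v, hv, hj, hk, h⟩ := h j k
    exact ⟨v, hv, hj, hk, by simpa using h.smul hs one_ne_zero one_ne_zero⟩

lemma HasTripleFlag.smul {T : Trilinear ι} (h : HasTripleFlag T) (r : ℂ) :
    HasTripleFlag (r • T) := by
  obtain ⟨L, M, W, h1, h2, h3, h4, h5, h⟩ := h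
  exact ⟨L, M, W, h1, h2, h3, h4, h5, fun l hl m hm w hw => by simp [h l hl m hm w hw]⟩

end Flags

/-! ### Dimension count: cubics with a flag satisfy a polynomial relation. -/

noncomputable section DimensionCount

open Module Submodule

variable {ι : Type*} [Fintype ι] [DecidableEq ι]

/-- The coordinate subspace spanned by some of the standard basis vectors. -/
def coordSpan (S : Set ι) : Submodule ℂ (ι → ℂ) :=
  span ℂ ((fun i => (Pi.single i 1 : ι → ℂ)) '' S)

lemma finrank_coordSpan (S : Finset ι) : finrank ℂ (coordSpan (S : Set ι)) = S.card := by
  have hli : LinearIndependent ℂ fun i : S => (Pi.single i.1 1 : ι → ℂ) := by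
    have := (Pi.basisFun ℂ ι).linearIndependent.comp (fun i : S => i.1) Subtype.val_injective
    convert this using 2
    simp
  have h := finrank_span_eq_card hli
  rw [Fintype.card_coe] at h
  rw [coordSpan, ← h, Set.image_eq_range]
  rfl

/-- A subspace disjoint from a coordinate subspace is complementary to a larger one. -/
lemma exists_isCompl_coordSpan {U : Submodule ℂ (ι → ℂ)} {S : Finset ι}
    (h : Disjoint U (coordSpan (S : Set ι))) :
    ∃ S' : Finset ι, S ⊆ S' ∧ IsCompl U (coordSpan (S' : Set ι)) := by
  -- Steinitz exchange: if `S'` is maximal with disjoint span, adding a further index creates an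
  -- intersection with `U`, which puts that standard vector in the sum.
  obtain ⟨S', hSS', hmax⟩ := (Set.toFinite {S' : Finset ι | Disjoint U
    (coordSpan (S' : Set ι))}).exists_le_maximal h
  refine ⟨S', hSS', hmax.prop, ?_⟩
  rw [codisjoint_iff, eq_top_iff, ← (Pi.basisFun ℂ ι).span_eq, span_le]
  rintro _ ⟨i, rfl⟩
  rw [Pi.basisFun_apply, SetLike.mem_coe]
  by_cases hi : i ∈ S'
  · exact mem_sup_right (subset_span ⟨i, hi, rfl⟩)
  have hnd : ¬ Disjoint U (coordSpan ((insert i S' : Finset ι) : Set ι)) := fun hd =>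
    hi (hmax.le_of_ge hd (Finset.subset_insert i S') (Finset.mem_insert_self i S'))
  rw [Submodule.disjoint_def] at hnd
  push Not at hnd
  obtain ⟨u, huU, hu, hu0⟩ := hnd
  rw [coordSpan, Finset.coe_insert, Set.image_insert_eq, mem_span_insert] at hu
  obtain ⟨c, s, hs, rfl⟩ := hu
  have hc : c ≠ 0 := by
    rintro rfl
    rw [zero_smul, zero_add] at huU hu0
    exact hu0 (Submodule.disjoint_def.1 hmax.prop s huU hs)
  have he : (Pi.single i 1 : ι → ℂ) = c⁻¹ • (c • Pi.single i 1 + s) + (-c⁻¹) • s := by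
    rw [smul_add, smul_smul, inv_mul_cancel₀ hc, one_smul, neg_smul]
    abel
  rw [he]
  exact add_mem (mem_sup_left (smul_mem _ _ huU)) (mem_sup_right (smul_mem _ _ hs))

/-- For a family of subspaces complementary to the coordinate subspaces of a filtration of the
coordinates, there are vectors in these subspaces in terms of which the standard basis is
unitriangular. -/
lemma exists_unitriangular {lev : ι → Fin 4} {U : Fin 4 → Submodule ℂ (ι → ℂ)}
    (hU : ∀ p, IsCompl (U p) (coordSpan {c | p < lev c})) :
    ∃ b H : ι → ι → ℂ, (∀ c, b c ∈ U (lev c)) ∧ (∀ c, H c c = 1) ∧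
      (∀ c a, a ≠ c → ¬ lev c < lev a → H c a = 0) ∧
      ∀ c, ∑ a, H c a • b a = Pi.single c 1 := by
  have hex : ∀ c, ∃ b ∈ U (lev c), ∃ r ∈ coordSpan {a | lev c < lev a},
      b + r = (Pi.single c 1 : ι → ℂ) := fun c =>
    mem_sup.1 ((hU (lev c)).sup_eq_top ▸ mem_top)
  choose b hb r hr hbr using hex
  -- Descending induction on the level: the correction r a involves only standard vectors of
  -- strictly higher level.
  have hle : ∀ p, coordSpan {a | p < lev a} ≤ span ℂ (b '' {a | p < lev a}) := by
    intro p
    induction p using WellFoundedGT.induction with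
    | _ p ih =>
      rw [coordSpan, span_le]
      rintro _ ⟨a, ha, rfl⟩
      change (Pi.single a 1 : ι → ℂ) ∈ _
      rw [← hbr a]
      refine add_mem (subset_span ⟨a, ha, rfl⟩) ?_
      exact span_mono (Set.image_mono fun x (hx : lev a < lev x) =>
        lt_trans (show p < lev a from ha) hx) (ih (lev a) ha (hr a))
  have hco : ∀ c, ∃ h : ι → ℂ, (∀ a, ¬ lev c < lev a → h a = 0) ∧ ∑ a, h a • b a = r c := by
    intro c
    have hx := hle _ (hr c)
    generalize r c = rc at hx ⊢
    induction hx using span_induction with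
    | zero => exact ⟨0, fun _ _ => rfl, by simp⟩
    | mem x hx =>
      obtain ⟨a, ha, rfl⟩ := hx
      refine ⟨Pi.single a 1, fun a' ha' => Pi.single_eq_of_ne (by rintro rfl; exact ha' ha) _, ?_⟩
      simp [Pi.single_apply]
    | add x y _ _ hx hy =>
      obtain ⟨h, h0, rfl⟩ := hx
      obtain ⟨h', h0', rfl⟩ := hy
      exact ⟨h + h', fun a ha => by simp [h0 a ha, h0' a ha],
        by simp [add_smul, Finset.sum_add_distrib]⟩
    | smul t x _ hx =>
      obtain ⟨h, h0, rfl⟩ := hx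
      exact ⟨t • h, fun a ha => by simp [h0 a ha], by simp [mul_smul, Finset.smul_sum]⟩
  choose h h0 hsum using hco
  refine ⟨b, fun c a => (if a = c then 1 else 0) + h c a, hb, fun c => ?_, fun c a hac hl => ?_,
    fun c => ?_⟩
  · simp [h0 c c (lt_irrefl _)]
  · simp [hac, h0 c a hl]
  · simp only [add_smul, Finset.sum_add_distrib, hsum, ← hbr c]
    simp

/-- Levels of the coordinates adapted to a flag of type `(2, 3, n - 1)`. -/
def IsFlagLevel (lev : ι → Fin 4) : Prop :=
  (Finset.univ.filter fun c => lev c = 0).card = 2 ∧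
    (Finset.univ.filter fun c => lev c = 1).card = 1 ∧
    (Finset.univ.filter fun c => lev c = 3).card = 2

/-- Every flag lies in one of finitely many affine charts of the flag variety, indexed by nested
coordinate complements of W, M and L. The entries of `H` at pairs of increasing level are the
coordinates in the chart. -/
lemma HasTripleFlag.exists_unitriangular {T : Trilinear ι} (hT : HasTripleFlag T) :
    ∃ lev : ι → Fin 4, IsFlagLevel lev ∧ ∃ b H : ι → ι → ℂ, (∀ c, H c c = 1) ∧
      (∀ c a, a ≠ c → ¬ lev c < lev a → H c a = 0) ∧
      (∀ c, ∑ a, H c a • b a = Pi.single c 1) ∧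
      ∀ i j k, lev i = 0 → lev j ≤ 1 → lev k ≤ 2 → T (b i) (b j) (b k) = 0 := by
  obtain ⟨L, M, W, hLM, hMW, hL, hM, hW, h⟩ := hT
  have hd0 : Disjoint W (coordSpan ((∅ : Finset ι) : Set ι)) := by simp [coordSpan]
  obtain ⟨S₂, -, h2⟩ := exists_isCompl_coordSpan hd0
  obtain ⟨S₁, h21, h1⟩ := exists_isCompl_coordSpan (h2.disjoint.mono_left hMW)
  obtain ⟨S₀, h10, h0⟩ := exists_isCompl_coordSpan (h1.disjoint.mono_left hLM)
  have hV : finrank ℂ (ι → ℂ) = Fintype.card ι := finrank_pi ℂ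
  have c0 := Submodule.finrank_add_eq_of_isCompl h0
  have c1 := Submodule.finrank_add_eq_of_isCompl h1
  have c2 := Submodule.finrank_add_eq_of_isCompl h2
  have cW := finrank_quotient_add_finrank W
  rw [finrank_coordSpan, hV] at c0 c1 c2
  rw [hV] at cW
  -- The complements are nested as S₂ ⊆ S₁ ⊆ S₀, and the level of a coordinate counts how many of
  -- them contain it.
  let lev : ι → Fin 4 := fun c =>
    if c ∈ S₂ then 3 else if c ∈ S₁ then 2 else if c ∈ S₀ then 1 else 0
  have l0 : ∀ c, lev c = 0 ↔ c ∈ S₀ᶜ := by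
    intro c
    have := @h21 c
    have := @h10 c
    simp only [lev, Finset.mem_compl]
    split_ifs <;> simp_all
  have l1 : ∀ c, lev c = 1 ↔ c ∈ S₀ \ S₁ := by
    intro c
    have := @h21 c
    have := @h10 c
    simp only [lev, Finset.mem_sdiff]
    split_ifs <;> simp_all
  have l3 : ∀ c, lev c = 3 ↔ c ∈ S₂ := by
    intro c
    simp only [lev]
    split_ifs <;> simp_all
  have hlev : IsFlagLevel lev := by
    refine ⟨?_, ?_, ?_⟩
    · simp only [l0, Finset.filter_univ_mem]
      rw [Finset.card_compl]
      omega
    · simp only [l1, Finset.filter_univ_mem]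
      rw [Finset.card_sdiff_of_subset h10]
      omega
    · simp only [l3, Finset.filter_univ_mem]
      omega
  have g0 : {c | 0 < lev c} = (S₀ : Set ι) := by
    ext c
    have := @h21 c
    have := @h10 c
    change 0 < lev c ↔ c ∈ S₀
    simp only [lev]
    split_ifs <;> simp_all
  have g1 : {c | 1 < lev c} = (S₁ : Set ι) := by
    ext c
    have := @h21 c
    change 1 < lev c ↔ c ∈ S₁
    simp only [lev]
    split_ifs <;> simp_all
  have g2 : {c | 2 < lev c} = (S₂ : Set ι) := by
    ext c
    change 2 < lev c ↔ c ∈ S₂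
    simp only [lev]
    split_ifs <;> simp_all
  have g3 : {c | 3 < lev c} = (∅ : Set ι) := by
    ext c
    change 3 < lev c ↔ c ∈ (∅ : Set ι)
    simp only [lev]
    split_ifs <;> simp
  let U : Fin 4 → Submodule ℂ (ι → ℂ) := ![L, M, W, ⊤]
  have hU : ∀ p, IsCompl (U p) (coordSpan {c | p < lev c}) := by
    intro p
    fin_cases p
    · change IsCompl L (coordSpan {c | 0 < lev c})
      rwa [g0]
    · change IsCompl M (coordSpan {c | 1 < lev c})
      rwa [g1]
    · change IsCompl W (coordSpan {c | 2 < lev c})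
      rwa [g2]
    · change IsCompl ⊤ (coordSpan {c | 3 < lev c})
      rw [g3, coordSpan, Set.image_empty, span_empty]
      exact isCompl_top_bot
  have hmono : Monotone U := by
    rw [Fin.monotone_iff_le_succ]
    intro i
    fin_cases i
    exacts [hLM, hMW, le_top]
  obtain ⟨b, H, hb, hH1, hH0, hH⟩ := _root_.exists_unitriangular hU
  refine ⟨lev, hlev, b, H, hH1, hH0, hH, fun i j k hi hj hk => h _ ?_ _ ?_ _ ?_⟩
  · exact hmono (hi.le : lev i ≤ 0) (hb i)
  · exact hmono hj (hb j)
  · exact hmono hk (hb k)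

/-- The exponents of cubic monomials in which the coefficient vanishes for a form with the standard
flag. -/
def IsFlagExp (lev : ι → Fin 4) (m : ι →₀ ℕ) : Prop :=
  ∃ i j k, lev i = 0 ∧ lev j ≤ 1 ∧ lev k ≤ 2 ∧ m = tripleExp i j k

/-- Exponents of cubic monomials. -/
abbrev CubicExp (ι : Type*) : Type _ := {m : ι →₀ ℕ // m.degree = 3}

section Counting

variable {lev : ι → Fin 4}

/-- The levels have sizes 2, 1, s, 2, so the increasing pairs number 2(1 + s + 2) + (s + 2) + 2s = 8
+ 5s, the dimension of the flag variety. -/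
lemma card_flagParams (hlev : IsFlagLevel lev) :
    Fintype.card {p : ι × ι // lev p.1 < lev p.2} =
      8 + 5 * Fintype.card {c // lev c = 2} := by
  obtain ⟨h0, h1, h3⟩ := hlev
  have hg : ∀ p : Fin 4, (Finset.univ.filter fun a => p < lev a).card =
      ∑ q, (Finset.univ.filter fun a => lev a = q).card * if p < q then 1 else 0 := by
    intro p
    rw [Finset.card_filter, ← Finset.sum_fiberwise Finset.univ lev]
    refine Finset.sum_congr rfl fun q _ => ?_
    rw [Finset.sum_congr rfl (g := fun _ => if p < q then 1 else 0)]
    · simp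
    · intro x hx
      rw [(Finset.mem_filter.1 hx).2]
  have h : Fintype.card {p : ι × ι // lev p.1 < lev p.2} =
      ∑ p, (Finset.univ.filter fun a => lev a = p).card *
        ∑ q, (Finset.univ.filter fun a => lev a = q).card * if p < q then 1 else 0 := by
    rw [Fintype.card_subtype, Finset.card_filter, Fintype.sum_prod_type,
      ← Finset.sum_fiberwise Finset.univ lev]
    refine Finset.sum_congr rfl fun p _ => ?_
    rw [Finset.sum_congr rfl (g := fun _ => (Finset.univ.filter fun a => p < lev a).card)]
    · rw [Finset.sum_const, smul_eq_mul, hg]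
    · intro x hx
      rw [← (Finset.mem_filter.1 hx).2, Finset.card_filter]
  rw [h, Fintype.card_subtype]
  simp [Fin.sum_univ_four, h0, h1, h3]
  ring

/-- With i, j of level 0 and k of level 1, nine monomials use i, j, k only (all but k³), and each
coordinate of level 2 contributes five more. This exceeds the number of flag parameters by one. -/
lemma card_flagExps (hlev : IsFlagLevel lev) :
    9 + 5 * Fintype.card {c // lev c = 2} ≤ Nat.card {m : CubicExp ι // IsFlagExp lev m.1} := by
  obtain ⟨h0, h1, -⟩ := hlev
  obtain ⟨i, j, hij, h0⟩ := Finset.card_eq_two.1 h0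
  obtain ⟨k, h1⟩ := Finset.card_eq_one.1 h1
  have hi : lev i = 0 := by
    have : i ∈ Finset.univ.filter fun c => lev c = 0 := by rw [h0]; simp
    simpa using this
  have hj : lev j = 0 := by
    have : j ∈ Finset.univ.filter fun c => lev c = 0 := by rw [h0]; simp
    simpa using this
  have hk : lev k = 1 := by
    have : k ∈ Finset.univ.filter fun c => lev c = 1 := by rw [h1]; simp
    simpa using this
  have hik : i ≠ k := by rintro rfl; simp [hi] at hk
  have hjk : j ≠ k := by rintro rfl; simp [hj] at hk
  let f9 : Fin 9 → ι →₀ ℕ := ![tripleExp i i i, tripleExp i i j, tripleExp i j j,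
    tripleExp j j j, tripleExp i i k, tripleExp i j k, tripleExp j j k, tripleExp i k k,
    tripleExp j k k]
  let f5 : ι → Fin 5 → ι →₀ ℕ := fun s => ![tripleExp i i s, tripleExp i j s, tripleExp j j s,
    tripleExp i k s, tripleExp j k s]
  -- The exponents of x_i and x_j distinguish the monomials within each list; the exponent of the
  -- level 2 coordinate distinguishes the lists.
  let n9 : Fin 9 → ℕ × ℕ := ![(3, 0), (2, 1), (1, 2), (0, 3), (2, 0), (1, 1), (0, 2), (1, 0),
    (0, 1)]
  let n5 : Fin 5 → ℕ × ℕ := ![(2, 0), (1, 1), (0, 2), (1, 0), (0, 1)]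
  have hn9 : Function.Injective n9 := by decide
  have hn5 : Function.Injective n5 := by decide
  have e9 : ∀ x, (f9 x i, f9 x j) = n9 x := by
    intro x
    fin_cases x <;> simp [f9, n9, tripleExp, hij, hij.symm, hik,
      hjk]
  have hs2 : ∀ s, lev s = 2 → s ≠ i ∧ s ≠ j ∧ s ≠ k := by
    intro s hs
    refine ⟨?_, ?_, ?_⟩ <;> rintro rfl <;> simp_all
  have e5 : ∀ s x, lev s = 2 → (f5 s x i, f5 s x j) = n5 x := by
    intro s x hs
    obtain ⟨hsi, hsj, hsk⟩ := hs2 s hs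
    fin_cases x <;> simp [f5, n5, tripleExp, hij, hij.symm, hik,
      hjk, hsi, hsj]
  have v9 : ∀ s x, lev s = 2 → f9 x s = 0 := by
    intro s x hs
    obtain ⟨hsi, hsj, hsk⟩ := hs2 s hs
    fin_cases x <;> simp [f9, tripleExp, hsi.symm, hsj.symm, hsk.symm]
  have v5 : ∀ s s' x, lev s = 2 → f5 s' x s = if s' = s then 1 else 0 := by
    intro s s' x hs
    obtain ⟨hsi, hsj, hsk⟩ := hs2 s hs
    fin_cases x <;> simp [f5, tripleExp, Finsupp.single_apply, hsi.symm, hsj.symm, hsk.symm]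
  have b9 : ∀ x, IsFlagExp lev (f9 x) := by
    have hk1 : lev k ≤ 1 := hk.le
    have hk2 : lev k ≤ 2 := hk.le.trans (by decide)
    have hi1 : ∀ p, lev i ≤ p := fun p => hi ▸ Fin.zero_le p
    have hj1 : ∀ p, lev j ≤ p := fun p => hj ▸ Fin.zero_le p
    intro x
    fin_cases x
    exacts [⟨i, i, i, hi, hi1 _, hi1 _, rfl⟩, ⟨i, i, j, hi, hi1 _, hj1 _, rfl⟩,
      ⟨i, j, j, hi, hj1 _, hj1 _, rfl⟩, ⟨j, j, j, hj, hj1 _, hj1 _, rfl⟩,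
      ⟨i, i, k, hi, hi1 _, hk2, rfl⟩, ⟨i, j, k, hi, hj1 _, hk2, rfl⟩,
      ⟨j, j, k, hj, hj1 _, hk2, rfl⟩, ⟨i, k, k, hi, hk1, hk2, rfl⟩, ⟨j, k, k, hj, hk1, hk2, rfl⟩]
  have b5 : ∀ s x, lev s = 2 → IsFlagExp lev (f5 s x) := by
    have hk1 : lev k ≤ 1 := hk.le
    have hi1 : ∀ p, lev i ≤ p := fun p => hi ▸ Fin.zero_le p
    have hj1 : ∀ p, lev j ≤ p := fun p => hj ▸ Fin.zero_le p
    intro s x hs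
    fin_cases x
    exacts [⟨i, i, s, hi, hi1 _, hs.le, rfl⟩, ⟨i, j, s, hi, hj1 _, hs.le, rfl⟩,
      ⟨j, j, s, hj, hj1 _, hs.le, rfl⟩, ⟨i, k, s, hi, hk1, hs.le, rfl⟩,
      ⟨j, k, s, hj, hk1, hs.le, rfl⟩]
  have hdeg : ∀ m, IsFlagExp lev m → m.degree = 3 := by
    rintro _ ⟨a, b, c, -, -, -, rfl⟩
    exact degree_tripleExp a b c
  let f : Fin 9 ⊕ Fin 5 × {c // lev c = 2} → {m : CubicExp ι // IsFlagExp lev m.1} :=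
    Sum.elim (fun x => ⟨⟨f9 x, hdeg _ (b9 x)⟩, b9 x⟩)
      fun y => ⟨⟨f5 y.2.1 y.1, hdeg _ (b5 _ _ y.2.2)⟩, b5 _ _ y.2.2⟩
  have hf : Function.Injective f := by
    have hval : ∀ x y, f x = f y → (f x).1.1 = (f y).1.1 := fun x y h => by rw [h]
    rintro (x | ⟨x, s, hs⟩) (y | ⟨y, s', hs'⟩) hxy
    · have h : f9 x = f9 y := hval _ _ hxy
      rw [hn9 (a₁ := x) (a₂ := y) (by rw [← e9, ← e9, h])]
    · have h : f9 x = f5 s' y := hval _ _ hxy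
      have h' := v5 s' s' y hs'
      rw [← h, v9 s' x hs', if_pos rfl] at h'
      exact absurd h' (by norm_num)
    · have h : f5 s x = f9 y := hval _ _ hxy
      have h' := v5 s s x hs
      rw [h, v9 s y hs, if_pos rfl] at h'
      exact absurd h' (by norm_num)
    · have h : f5 s x = f5 s' y := hval _ _ hxy
      have h' := v5 s s x hs
      rw [h, v5 s s' y hs, if_pos rfl] at h'
      have hss : s' = s := by
        by_contra hne
        rw [if_neg hne] at h'
        exact absurd h' (by norm_num)
      subst hss
      rw [hn5 (a₁ := x) (a₂ := y) (by rw [← e5 s' x hs, ← e5 s' y hs, h])]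
  have := Nat.card_le_card_of_injective f hf
  simp only [Nat.card_eq_fintype_card, Fintype.card_sum, Fintype.card_prod, Fintype.card_fin]
    at this ⊢
  exact this

end Counting

/-- The parameters of the forms that have a flag with given levels. -/
abbrev FlagParams (lev : ι → Fin 4) : Type _ :=
  {p : ι × ι // lev p.1 < lev p.2} ⊕ {m : CubicExp ι // ¬ IsFlagExp lev m.1}

lemma card_flagParams_lt {lev : ι → Fin 4} (hlev : IsFlagLevel lev) :
    Nat.card (FlagParams lev) < Nat.card (CubicExp ι) := by
  classical
  have h1 := card_flagParams hlev
  have h2 := card_flagExps hlev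
  have h3 : Nat.card {m : CubicExp ι // IsFlagExp lev m.1} +
      Nat.card {m : CubicExp ι // ¬ IsFlagExp lev m.1} = Nat.card (CubicExp ι) := by
    rw [← Nat.card_sum]
    exact Nat.card_congr (Equiv.sumCompl _)
  rw [Nat.card_sum, Nat.card_eq_fintype_card (α := {p : ι × ι // lev p.1 < lev p.2})]
  omega

/-- The universal unitriangular matrix with given levels. -/
def universalMatrix (lev : ι → Fin 4) (c a : ι) : MvPolynomial (FlagParams lev) ℂ :=
  if a = c then 1 else if h : lev c < lev a then X (Sum.inl ⟨(c, a), h⟩) else 0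

/-- The universal cubic form that has a flag with given levels. -/
def universalForm (lev : ι → Fin 4) : MvPolynomial ι (MvPolynomial (FlagParams lev) ℂ) :=
  open Classical in
  bind₁ (fun a => ∑ c, C (universalMatrix lev c a) * X c)
    (∑ m : {m : CubicExp ι // ¬ IsFlagExp lev m.1}, monomial m.1.1 (X (Sum.inr m)))

/-- Polynomials in fewer variables than there are of them are algebraically dependent. -/
lemma exists_algebraic_relation {σ ρ : Type} [Finite σ] [Finite ρ]
    (f : ρ → MvPolynomial σ ℂ) (h : Nat.card σ < Nat.card ρ) :
    ∃ Q : MvPolynomial ρ ℂ, Q ≠ 0 ∧ aeval f Q = 0 := by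
  by_contra hcon
  push Not at hcon
  have hind : AlgebraicIndependent ℂ f := by
    rw [algebraicIndependent_iff]
    intro Q hQ
    by_contra hne
    exact hcon Q hne hQ
  have hle := hind.cardinalMk_le_trdeg
  rw [MvPolynomial.trdeg_of_isDomain, Cardinal.lift_id] at hle
  exact h.not_ge (Nat.card_le_card_of_injective _
    (Cardinal.le_def _ _ |>.1 hle).some.injective)

/-- In the coordinates b the form lacks the flag monomials, so it is a specialization of the generic
form without them; substituting `H` undoes the change to b. -/
lemma map_universalForm {lev : ι → Fin 4} (φ : MvPolynomial (FlagParams lev) ℂ →+* ℂ)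
    {b H : ι → ι → ℂ} {F : MvPolynomial ι ℂ} (hF : F.IsHomogeneous 3)
    (hH : ∀ c a, φ (universalMatrix lev c a) = H c a)
    (hb : ∀ c, ∑ a, H c a • b a = Pi.single c 1)
    (hc : ∀ m, φ (X (Sum.inr m)) = coeff m.1.1 (linearSubst b F))
    (h0 : ∀ m : CubicExp ι, IsFlagExp lev m.1 → coeff m.1 (linearSubst b F) = 0) :
    map φ (universalForm lev) = F := by
  classical
  have hsum : map φ (∑ m : {m : CubicExp ι // ¬ IsFlagExp lev m.1},
      monomial m.1.1 (X (Sum.inr m))) = linearSubst b F := by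
    rw [map_sum]
    simp only [map_monomial, hc]
    ext m
    rw [coeff_sum]
    simp only [coeff_monomial]
    by_cases hm : m.degree = 3
    · by_cases hbad : IsFlagExp lev m
      · rw [h0 ⟨m, hm⟩ hbad]
        refine Finset.sum_eq_zero fun x _ => if_neg ?_
        rintro rfl
        exact x.2 hbad
      · rw [Finset.sum_eq_single ⟨⟨m, hm⟩, hbad⟩]
        · simp
        · rintro x _ hx
          refine if_neg ?_
          rintro rfl
          exact hx rfl
        · simp
    · rw [(isHomogeneous_linearSubst b hF).coeff_eq_zero hm]
      refine Finset.sum_eq_zero fun x _ => if_neg ?_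
      rintro rfl
      exact hm x.1.2
  have hsub : map φ (universalForm lev) = linearSubst H (linearSubst b F) := by
    rw [universalForm, map_bind₁, hsum, linearSubst]
    congr 2
    ext1 a
    simp [hH]
  rw [hsub]
  refine MvPolynomial.funext fun x => ?_
  rw [eval_linearSubst, eval_linearSubst]
  congr 2
  have : ∀ a, (∑ c, x c • H c) a = ∑ c, x c * H c a := fun a => by simp
  simp only [this, Finset.sum_smul, mul_smul]
  rw [Finset.sum_comm]
  simp only [← Finset.smul_sum, hb]
  ext i
  simp [Pi.single_apply]

/-- The cubic forms with a triple flag lie on a hypersurface in the space of cubic forms. -/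
theorem exists_relation_of_hasTripleFlag (ι : Type) [Fintype ι] [DecidableEq ι] :
    ∃ Q : MvPolynomial (CubicExp ι) ℂ, Q ≠ 0 ∧ ∀ F : MvPolynomial ι ℂ, F.IsHomogeneous 3 →
      HasTripleFlag (polarForm F) → eval (fun m : CubicExp ι => coeff m.1 F) Q = 0 := by
  have hlev : ∀ lev : {lev : ι → Fin 4 // IsFlagLevel lev},
      ∃ Q : MvPolynomial (CubicExp ι) ℂ, Q ≠ 0 ∧
        aeval (fun m : CubicExp ι => coeff m.1 (universalForm lev.1)) Q = 0 := fun lev => by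
    classical
    exact exists_algebraic_relation _ (card_flagParams_lt lev.2)
  choose Q hQ0 hQ using hlev
  classical
  -- One relation for each of the finitely many charts; their product vanishes on all cubics with a
  -- flag.
  refine ⟨∏ lev, Q lev, Finset.prod_ne_zero_iff.2 fun lev _ => hQ0 lev, fun F hF hflag => ?_⟩
  obtain ⟨lev, hl, b, H, hH1, hH0, hH, hT⟩ := hflag.exists_unitriangular
  rw [map_prod]
  refine Finset.prod_eq_zero (Finset.mem_univ ⟨lev, hl⟩) ?_
  let φ : MvPolynomial (FlagParams lev) ℂ →ₐ[ℂ] ℂ :=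
    aeval (Sum.elim (fun p => H p.1.1 p.1.2) fun m => coeff m.1.1 (linearSubst b F))
  have hmap : map (φ : MvPolynomial (FlagParams lev) ℂ →+* ℂ) (universalForm lev) = F := by
    refine map_universalForm _ (b := b) (H := H) hF (fun c a => ?_) hH (fun m => ?_) ?_
    · rw [universalMatrix]
      split_ifs with h1 h2
      · subst h1
        simp [hH1]
      · simp [φ]
      · simp [hH0 c a h1 h2]
    · simp [φ]
    · rintro ⟨_, hm⟩ ⟨i, j, k, hi, hj, hk, rfl⟩
      have h1 := thirdDerivs_eq_coeff (linearSubst b F) i j k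
      rw [thirdDerivs_linearSubst b hF, hT i j k hi hj hk] at h1
      exact (mul_eq_zero.1 h1.symm).resolve_right (derivFactor_ne_zero i j k)
  have h := congrArg φ (hQ ⟨lev, hl⟩)
  rw [map_zero, ← AlgHom.comp_apply, comp_aeval] at h
  rw [← coe_aeval_eq_eval, RingHom.coe_coe, ← h]
  congr 2
  ext m
  conv_lhs => rw [← hmap, coeff_map]
  rfl

end DimensionCount

/-! ### The trilinear form of a normal form; pencils of binary quadrics. -/

noncomputable section NormalForm

open Module Submodule

lemma HasTripleFlag.of_linearSubst {n : ℕ} {F : MvPolynomial (Fin (n + 1)) ℂ}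
    (hF : F.IsHomogeneous 3) (b : Basis (Fin (n + 1)) ℂ (Fin (n + 1) → ℂ))
    (h : HasTripleFlag (polarForm (linearSubst b F))) : HasTripleFlag (polarForm F) := by
  obtain ⟨L, M, W, hLM, hMW, hL, hM, hW, h⟩ := h
  let e := b.equivFun.symm
  have he : ∀ x, e x = ∑ a, x a • b a := b.equivFun_symm_apply
  have cW := finrank_quotient_add_finrank W
  have cW' := finrank_quotient_add_finrank (W.map e.toLinearMap)
  rw [LinearEquiv.finrank_map_eq] at cW'
  refine ⟨L.map e.toLinearMap, M.map e.toLinearMap,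
    W.map e.toLinearMap, map_mono hLM, map_mono hMW, ?_, ?_, ?_, ?_⟩
  · rw [LinearEquiv.finrank_map_eq, hL]
  · rw [LinearEquiv.finrank_map_eq, hM]
  · omega
  · rintro _ ⟨l, hl, rfl⟩ _ ⟨m, hm, rfl⟩ _ ⟨w, hw, rfl⟩
    have := h l hl m hm w hw
    rw [polarForm_linearSubst _ hF] at this
    simpa only [LinearEquiv.coe_coe, he] using this

section FromNormalForm

variable {n : ℕ} {A B : Matrix (Fin (n + 1)) (Fin (n + 1)) ℂ}
  {G : MvPolynomial (Fin (n + 1)) ℂ}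

/-- The indices `2, …, n`. -/
abbrev tailIndices (n : ℕ) : Finset (Fin (n + 1)) :=
  Finset.univ.filter fun k : Fin (n + 1) => 2 ≤ (k : ℕ)

/-- The normal form of a cubic along a line of the second type. -/
def normalForm (A B : Matrix (Fin (n + 1)) (Fin (n + 1)) ℂ)
    (G : MvPolynomial (Fin (n + 1)) ℂ) : MvPolynomial (Fin (n + 1)) ℂ :=
  X 2 * X 0 ^ 2 + X 3 * X 1 ^ 2 +
    (∑ i ∈ tailIndices n, ∑ j ∈ tailIndices n, X i * X j * linearEntry A B i j) + G

/-- The bilinear form of a matrix on the coordinates `2, …, n`. -/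
def tailBilin (A : Matrix (Fin (n + 1)) (Fin (n + 1)) ℂ) (y z : Fin (n + 1) → ℂ) : ℂ :=
  ∑ i ∈ tailIndices n, ∑ j ∈ tailIndices n, A i j * (y i * z j)

lemma tailBilin_comm (hA : A.IsSymm) (y z : Fin (n + 1) → ℂ) :
    tailBilin A y z = tailBilin A z y := by
  rw [tailBilin, tailBilin, Finset.sum_comm]
  refine Finset.sum_congr rfl fun i _ => Finset.sum_congr rfl fun j _ => ?_
  rw [hA.apply]
  ring

lemma tailBilin_add_add (y z : Fin (n + 1) → ℂ) :
    tailBilin A (y + z) (y + z) =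
      tailBilin A y y + tailBilin A y z + tailBilin A z y + tailBilin A z z := by
  simp only [tailBilin, ← Finset.sum_add_distrib]
  refine Finset.sum_congr rfl fun i _ => Finset.sum_congr rfl fun j _ => ?_
  simp only [Pi.add_apply]
  ring

lemma pderiv_head {a k : Fin (n + 1)} (ha : (a : ℕ) < 2) (hk : k ∈ tailIndices n) :
    pderiv a (X k : MvPolynomial (Fin (n + 1)) ℂ) = 0 := by
  refine pderiv_X_of_ne ?_
  rintro rfl
  have := (Finset.mem_filter.1 hk).2
  omega

lemma eval_pderiv_tail {a : Fin (n + 1)} (ha : (a : ℕ) < 2) (y : Fin (n + 1) → ℂ)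
    {D : Matrix (Fin (n + 1)) (Fin (n + 1)) ℂ}
    (hD : ∀ i j, eval y (pderiv a (linearEntry A B i j)) = D i j) :
    eval y (pderiv a (∑ i ∈ tailIndices n, ∑ j ∈ tailIndices n,
      X i * X j * linearEntry A B i j)) = tailBilin D y y := by
  simp only [map_sum, tailBilin]
  refine Finset.sum_congr rfl fun i hi => Finset.sum_congr rfl fun j hj => ?_
  rw [pderiv_mul, pderiv_mul, pderiv_head ha hi, pderiv_head ha hj]
  simp [hD, mul_comm]

/-- The derivative of the normal form by x_0 is the quadratic form 2 x_2 x_0 + A(x, x); polarizing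
twice this form gives the formula. -/
lemma polarForm_normalForm_head (hn : 4 ≤ n) (hA : A.IsSymm)
    (hG : ∀ i ∈ G.vars, 2 ≤ (i : ℕ)) (hF : (normalForm A B G).IsHomogeneous 3)
    (y z : Fin (n + 1) → ℂ) :
    polarForm (normalForm A B G) (Pi.single 0 1) y z =
      2 * (y 2 * z 0 + y 0 * z 2) + 2 * tailBilin A y z := by
  obtain ⟨n, rfl⟩ := Nat.exists_eq_add_of_le' hn
  have hq : ∀ y, polarForm (normalForm A B G) (Pi.single 0 1) y y =
      4 * (y 2 * y 0) + 2 * tailBilin A y y := by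
    intro y
    rw [polarForm_diag_eq_gradient hF, Finset.sum_eq_single 0 (by simp +contextual) (by simp)]
    have hG0 : pderiv 0 G = 0 :=
      pderiv_eq_zero_of_notMem_vars fun h => by simpa using hG 0 h
    have hlin : ∀ i j, eval y (pderiv 0 (linearEntry A B i j)) = A i j := fun i j => by
      simp [linearEntry]
    have h20 : pderiv 0 (X 2 : MvPolynomial (Fin (n + 4 + 1)) ℂ) = 0 := pderiv_X_of_ne (by
      simp [Fin.ext_iff, Nat.mod_eq_of_lt])
    have h30 : pderiv 0 (X 3 : MvPolynomial (Fin (n + 4 + 1)) ℂ) = 0 := pderiv_X_of_ne (by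
      simp [Fin.ext_iff, Nat.mod_eq_of_lt])
    have h10 : pderiv 0 (X 1 : MvPolynomial (Fin (n + 4 + 1)) ℂ) = 0 := pderiv_X_of_ne (by
      simp)
    have ht := eval_pderiv_tail (A := A) (B := B) (a := 0) (by simp) y hlin
    simp only [normalForm, map_add, ht, hG0, pderiv_mul, pderiv_pow, h20, h30, h10, pderiv_X_self]
    simp only [Pi.single_eq_same, one_mul, map_mul, eval_X, map_pow, map_zero,
      map_natCast, map_one]
    push_cast
    ring
  have h := hq (y + z)
  rw [tailBilin_add_add, tailBilin_comm hA z y] at h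
  simp only [map_add, LinearMap.add_apply, hq, Pi.add_apply] at h
  rw [polarForm_swap_right _ _ z y] at h
  linear_combination h / 2

lemma polarForm_normalForm_snd (hn : 4 ≤ n) (hB : B.IsSymm)
    (hG : ∀ i ∈ G.vars, 2 ≤ (i : ℕ)) (hF : (normalForm A B G).IsHomogeneous 3)
    (y z : Fin (n + 1) → ℂ) :
    polarForm (normalForm A B G) (Pi.single 1 1) y z =
      2 * (y 3 * z 1 + y 1 * z 3) + 2 * tailBilin B y z := by
  obtain ⟨n, rfl⟩ := Nat.exists_eq_add_of_le' hn
  have hq : ∀ y, polarForm (normalForm A B G) (Pi.single 1 1) y y =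
      4 * (y 3 * y 1) + 2 * tailBilin B y y := by
    intro y
    rw [polarForm_diag_eq_gradient hF, Finset.sum_eq_single 1 (by simp +contextual) (by simp)]
    have hG0 : pderiv 1 G = 0 :=
      pderiv_eq_zero_of_notMem_vars fun h => by simpa using hG 1 h
    have hlin : ∀ i j, eval y (pderiv 1 (linearEntry A B i j)) = B i j := fun i j => by
      simp [linearEntry]
    have h20 : pderiv 1 (X 2 : MvPolynomial (Fin (n + 4 + 1)) ℂ) = 0 := pderiv_X_of_ne (by
      simp [Fin.ext_iff, Nat.mod_eq_of_lt])
    have h30 : pderiv 1 (X 3 : MvPolynomial (Fin (n + 4 + 1)) ℂ) = 0 := pderiv_X_of_ne (by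
      simp [Fin.ext_iff, Nat.mod_eq_of_lt])
    have h10 : pderiv 1 (X 0 : MvPolynomial (Fin (n + 4 + 1)) ℂ) = 0 := pderiv_X_of_ne (by
      simp)
    have ht := eval_pderiv_tail (A := A) (B := B) (a := 1) (by simp) y hlin
    simp only [normalForm, map_add, ht, hG0, pderiv_mul, pderiv_pow, h20, h30, h10, pderiv_X_self]
    simp only [Pi.single_eq_same, one_mul, map_mul, eval_X, map_pow, map_zero,
      map_natCast, map_one]
    push_cast
    ring
  have h := hq (y + z)
  rw [tailBilin_add_add, tailBilin_comm hB z y] at h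
  simp only [map_add, LinearMap.add_apply, hq, Pi.add_apply] at h
  rw [polarForm_swap_right _ _ z y] at h
  linear_combination h / 2

end FromNormalForm

section BinaryQuadrics

lemma exists_binary_quadratic_zero (a b c : ℂ) :
    ∃ x y : ℂ, (x ≠ 0 ∨ y ≠ 0) ∧ a * x ^ 2 + b * x * y + c * y ^ 2 = 0 := by
  by_cases ha : a = 0
  · exact ⟨1, 0, Or.inl one_ne_zero, by simp [ha]⟩
  · obtain ⟨s, hs⟩ := IsAlgClosed.exists_eq_mul_self (discrim a b c)
    obtain ⟨x, hx⟩ := exists_quadratic_eq_zero ha ⟨s, hs⟩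
    exact ⟨x, 1, Or.inr one_ne_zero, by linear_combination hx⟩

lemma exists_kernel_two_by_two {a b c d : ℂ} (h : a * d - b * c = 0) :
    ∃ x y : ℂ, (x ≠ 0 ∨ y ≠ 0) ∧ x * a + y * b = 0 ∧ x * c + y * d = 0 := by
  have hdet : (!![a, b; c, d]).det = 0 := by rw [Matrix.det_fin_two_of, h]
  obtain ⟨v, hv, hmv⟩ := Matrix.exists_mulVec_eq_zero_iff.2 hdet
  refine ⟨v 0, v 1, ?_, ?_, ?_⟩
  · by_contra hcon
    push Not at hcon
    refine hv (funext fun i => ?_)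
    fin_cases i
    exacts [hcon.1, hcon.2]
  · have := congrFun hmv 0
    simp [Matrix.mulVec, dotProduct, Fin.sum_univ_two] at this
    linear_combination this
  · have := congrFun hmv 1
    simp [Matrix.mulVec, dotProduct, Fin.sum_univ_two] at this
    linear_combination this

/-- Simultaneous diagonalization of two binary quadratic forms without common zeros. -/
lemma exists_simultaneous_diagonalization {V : Type*} [AddCommGroup V] [Module ℂ V]
    {u₀ u₁ : V} (hu : LinearIndependent ℂ ![u₀, u₁]) (q r : V →ₗ[ℂ] V →ₗ[ℂ] ℂ)
    (hq : ∀ x y, q x y = q y x) (hr : ∀ x y, r x y = r y x)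
    (hz : ∀ x y : ℂ, (x ≠ 0 ∨ y ≠ 0) → q (x • u₀ + y • u₁) (x • u₀ + y • u₁) = 0 →
      r (x • u₀ + y • u₁) (x • u₀ + y • u₁) ≠ 0) :
    ∃ b₀ ∈ span ℂ {u₀, u₁}, ∃ b₁ ∈ span ℂ {u₀, u₁}, LinearIndependent ℂ ![b₀, b₁] ∧
      q b₀ b₁ = 0 ∧ r b₀ b₁ = 0 ∧ q b₀ b₀ * r b₁ b₁ - q b₁ b₁ * r b₀ b₀ ≠ 0 := by
  have hz' : ∀ l ∈ span ℂ {u₀, u₁}, l ≠ 0 → q l l = 0 → r l l ≠ 0 := by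
    intro l hl hl0
    obtain ⟨x, y, rfl⟩ := mem_span_pair.1 hl
    refine hz x y ?_
    by_contra hcon
    push Not at hcon
    exact hl0 (by simp [hcon.1, hcon.2])
  have hcomb : ∀ x y : ℂ, (x ≠ 0 ∨ y ≠ 0) → x • u₀ + y • u₁ ≠ 0 := by
    intro x y hxy h0
    obtain ⟨h1, h2⟩ := LinearIndependent.pair_iff.1 hu x y h0
    rcases hxy with h | h
    exacts [h h1, h h2]
  -- The coefficients are those of the Jacobian q(b₀, u₀) r(b₀, u₁) - q(b₀, u₁) r(b₀, u₀) in b₀ = x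
  -- u₀ + y u₁. At a zero the two forms q(b₀, ·) and r(b₀, ·) are dependent and have a common kernel
  -- vector b₁.
  obtain ⟨x, y, hxy, h⟩ := exists_binary_quadratic_zero
    (q u₀ u₀ * r u₀ u₁ - q u₀ u₁ * r u₀ u₀)
    (q u₀ u₀ * r u₁ u₁ + q u₁ u₀ * r u₀ u₁ - q u₀ u₁ * r u₁ u₀ - q u₁ u₁ * r u₀ u₀)
    (q u₁ u₀ * r u₁ u₁ - q u₁ u₁ * r u₁ u₀)
  set b₀ := x • u₀ + y • u₁ with hb₀
  have hb₀0 := hcomb x y hxy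
  obtain ⟨s, t, hst, h1, h2⟩ := exists_kernel_two_by_two
    (a := q b₀ u₀) (b := q b₀ u₁) (c := r b₀ u₀) (d := r b₀ u₁) (by
      simp only [hb₀, map_add, map_smul, LinearMap.add_apply, LinearMap.smul_apply, smul_eq_mul]
      linear_combination h)
  set b₁ := s • u₀ + t • u₁ with hb₁
  have hb₁0 := hcomb s t hst
  have m0 : b₀ ∈ span ℂ {u₀, u₁} := mem_span_pair.2 ⟨x, y, rfl⟩
  have m1 : b₁ ∈ span ℂ {u₀, u₁} := mem_span_pair.2 ⟨s, t, rfl⟩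
  have hq01 : q b₀ b₁ = 0 := by
    rw [hb₁, map_add, map_smul, map_smul]
    exact h1
  have hr01 : r b₀ b₁ = 0 := by
    rw [hb₁, map_add, map_smul, map_smul]
    exact h2
  -- If b₀ were a multiple of b₁, then q(b₀, b₀) = r(b₀, b₀) = 0, a common zero.
  have hli : LinearIndependent ℂ ![b₀, b₁] := by
    rw [LinearIndependent.pair_iff]
    intro α β hαβ
    have hα : α = 0 := by
      by_contra hα
      have e1 : α * q b₀ b₀ + β * q b₀ b₁ = 0 := by
        rw [← smul_eq_mul, ← smul_eq_mul, ← map_smul, ← map_smul, ← map_add, hαβ, map_zero]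
      have e2 : α * r b₀ b₀ + β * r b₀ b₁ = 0 := by
        rw [← smul_eq_mul, ← smul_eq_mul, ← map_smul, ← map_smul, ← map_add, hαβ, map_zero]
      rw [hq01, mul_zero, add_zero] at e1
      rw [hr01, mul_zero, add_zero] at e2
      exact hz' b₀ m0 hb₀0 ((mul_eq_zero.1 e1).resolve_left hα)
        ((mul_eq_zero.1 e2).resolve_left hα)
    rw [hα, zero_smul, zero_add] at hαβ
    exact ⟨hα, (smul_eq_zero.1 hαβ).resolve_right hb₁0⟩
  refine ⟨b₀, m0, b₁, m1, hli, hq01, hr01, fun hdet => ?_⟩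
  obtain ⟨α, β, hαβ, h3, h4⟩ := exists_kernel_two_by_two
    (a := q b₀ b₀) (b := q b₁ b₁) (c := r b₀ b₀) (d := r b₁ b₁) hdet
  -- In a diagonalizing basis the forms are linear in the squares of the coordinates, so square
  -- roots of a kernel vector of the determinant give a common zero.
  obtain ⟨α', rfl⟩ := IsAlgClosed.exists_eq_mul_self α
  obtain ⟨β', rfl⟩ := IsAlgClosed.exists_eq_mul_self β
  have hne : α' • b₀ + β' • b₁ ≠ 0 := by
    intro h0
    obtain ⟨h1, h2⟩ := LinearIndependent.pair_iff.1 hli _ _ h0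
    simp [h1, h2] at hαβ
  refine hz' _ (add_mem (smul_mem _ _ m0) (smul_mem _ _ m1)) hne ?_ ?_
  · simp only [map_add, map_smul, LinearMap.add_apply, LinearMap.smul_apply, smul_eq_mul,
      hq b₁ b₀, hq01]
    linear_combination h3
  · simp only [map_add, map_smul, LinearMap.add_apply, LinearMap.smul_apply, smul_eq_mul,
      hr b₁ b₀, hr01]
    linear_combination h4

end BinaryQuadrics

end NormalForm

/-! ### From higher triple lines to flags, and bases adapted to a flag. -/

noncomputable section HigherTripleLines

open Module Submodule

/-- A form in second type normal form whose second order part degenerates has a triple flag. -/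
lemma hasTripleFlag_normalForm {n : ℕ} (hn : 4 ≤ n) {A B : Matrix (Fin (n + 1)) (Fin (n + 1)) ℂ}
    {G : MvPolynomial (Fin (n + 1)) ℂ} (hA : A.IsSymm) (hB : B.IsSymm)
    (hG : ∀ i ∈ G.vars, 2 ≤ (i : ℕ)) (hF : (normalForm A B G).IsHomogeneous 3)
    (hdeg : SecondOrderDegenerates A B) : HasTripleFlag (polarForm (normalForm A B G)) := by
  have hT0 := polarForm_normalForm_head hn hA hG hF
  have hT1 := polarForm_normalForm_snd hn hB hG hF
  have v0 : ((0 : Fin (n + 1)) : ℕ) = 0 := rfl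
  have v1 : ((1 : Fin (n + 1)) : ℕ) = 1 := by
    rw [Fin.val_one']; exact Nat.mod_eq_of_lt (by omega)
  have v2 : ((2 : Fin (n + 1)) : ℕ) = 2 :=
    (show _ = 2 % (n + 1) from rfl).trans (Nat.mod_eq_of_lt (by omega))
  have v3 : ((3 : Fin (n + 1)) : ℕ) = 3 :=
    (show _ = 3 % (n + 1) from rfl).trans (Nat.mod_eq_of_lt (by omega))
  rw [SecondOrderDegenerates, Fintype.linearIndependent_iff] at hdeg
  push Not at hdeg
  obtain ⟨c, hc, j₀, hj₀⟩ := hdeg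
  -- The column dependency, extended by zero, is the extra direction of M. The flag is L = ⟨e_0,
  -- e_1⟩, M = L + ⟨v⟩ and W = {x_2 = x_3 = 0}.
  let v : Fin (n + 1) → ℂ := fun k => if h : 4 ≤ (k : ℕ) then c ⟨k, h⟩ else 0
  have hvs : ∀ k : Fin (n + 1), (k : ℕ) < 4 → v k = 0 := fun k hk => dif_neg (by omega)
  have hvj : v j₀.1 ≠ 0 := by
    simpa only [v, dif_pos j₀.2] using hj₀
  have hsumv : ∀ g : Fin (n + 1) → ℂ, ∑ j ∈ tailIndices n, g j * v j = ∑ j, c j * g j.1 := by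
    intro g
    have h1 : ∑ j, c j * g j.1 = ∑ j ∈ Finset.univ.filter (fun k : Fin (n + 1) => 4 ≤ (k : ℕ)),
        g j * v j := by
      rw [Finset.sum_subtype (p := fun k : Fin (n + 1) => 4 ≤ (k : ℕ)) _ (by simp)]
      refine Finset.sum_congr rfl fun j _ => ?_
      simp only [v, dif_pos j.2]
      rw [mul_comm]
    rw [h1]
    symm
    refine Finset.sum_subset (fun k hk => ?_) fun k _ hk => ?_
    · rw [Finset.mem_filter] at hk ⊢
      exact ⟨hk.1, by omega⟩
    · rw [hvs k (by simpa using hk), mul_zero]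
  have hker : ∀ i : Fin (n + 1), 4 ≤ (i : ℕ) →
      ∑ j ∈ tailIndices n, A i j * v j = 0 ∧ ∑ j ∈ tailIndices n, B i j * v j = 0 := by
    intro i hi
    have h := congrFun hc ⟨i, hi⟩
    simp only [Finset.sum_apply, Pi.smul_apply, Pi.zero_apply] at h
    rw [hsumv, hsumv]
    have h01 : (0 : Fin (n + 1)) ≠ 1 := by
      intro h
      rw [Fin.ext_iff, v0, v1] at h
      omega
    -- Evaluating the linear forms at e_0 and at e_1 separates the relation into one for `A` and one
    -- for `B`.
    constructor
    · have := congrArg (eval (Pi.single 0 1)) h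
      simpa [linearEntry, smul_eval, h01.symm] using this
    · have := congrArg (eval (Pi.single 1 1)) h
      simpa [linearEntry, smul_eval, h01] using this
  have hker' : ∀ (D : Matrix (Fin (n + 1)) (Fin (n + 1)) ℂ), D.IsSymm →
      (∀ i : Fin (n + 1), 4 ≤ (i : ℕ) → ∑ j ∈ tailIndices n, D i j * v j = 0) →
      ∀ w : Fin (n + 1) → ℂ, w 2 = 0 → w 3 = 0 → tailBilin D v w = 0 := by
    intro D hD hDv w hw2 hw3
    rw [tailBilin_comm hD, tailBilin]
    refine Finset.sum_eq_zero fun i hi => ?_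
    have : ∑ j ∈ tailIndices n, D i j * (w i * v j) = w i * ∑ j ∈ tailIndices n, D i j * v j := by
      rw [Finset.mul_sum]
      exact Finset.sum_congr rfl fun j _ => by ring
    rw [this]
    by_cases h4 : 4 ≤ (i : ℕ)
    · rw [hDv i h4, mul_zero]
    · have h2 := (Finset.mem_filter.1 hi).2
      have hi23 : i = 2 ∨ i = 3 := by
        rw [Fin.ext_iff, Fin.ext_iff, v2, v3]
        omega
      rcases hi23 with rfl | rfl
      · rw [hw2, zero_mul]
      · rw [hw3, zero_mul]
  have hhead : ∀ (D : Matrix (Fin (n + 1)) (Fin (n + 1)) ℂ) (a : Fin (n + 1)) (w : Fin (n + 1) → ℂ),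
      (a : ℕ) < 2 → tailBilin D (Pi.single a 1) w = 0 := by
    intro D a w ha
    refine Finset.sum_eq_zero fun i hi => Finset.sum_eq_zero fun j _ => ?_
    have h2 := (Finset.mem_filter.1 hi).2
    rw [Pi.single_eq_of_ne (by rintro rfl; omega), zero_mul, mul_zero]
  have hne : ∀ a b : Fin (n + 1), (a : ℕ) ≠ b → a ≠ b := fun a b h h' => h (by rw [h'])
  have hli : LinearIndependent ℂ ![(Pi.single 0 1 : Fin (n + 1) → ℂ), Pi.single 1 1, v] := by
    rw [Fintype.linearIndependent_iff]
    intro g hg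
    simp only [Fin.sum_univ_three, Matrix.cons_val_zero, Matrix.cons_val_one,
      Matrix.cons_val] at hg
    have j4 := j₀.2
    have e2 := congrFun hg j₀.1
    simp only [Pi.add_apply, Pi.smul_apply, smul_eq_mul,
      Pi.single_eq_of_ne (hne j₀.1 0 (by omega)), Pi.single_eq_of_ne (hne j₀.1 1 (by omega)),
      mul_zero, zero_add, Pi.zero_apply] at e2
    have g2 : g 2 = 0 := (mul_eq_zero.1 e2).resolve_right hvj
    have e0 := congrFun hg 0
    simp only [Pi.add_apply, Pi.smul_apply, smul_eq_mul, Pi.single_eq_same,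
      Pi.single_eq_of_ne (hne 0 1 (by omega)), mul_zero, g2, zero_mul, mul_one, add_zero,
      Pi.zero_apply] at e0
    have e1 := congrFun hg 1
    simp only [Pi.add_apply, Pi.smul_apply, smul_eq_mul, Pi.single_eq_same,
      Pi.single_eq_of_ne (hne 1 0 (by omega)), mul_zero, g2, zero_mul, mul_one, add_zero,
      zero_add, Pi.zero_apply] at e1
    intro i
    fin_cases i
    exacts [e0, e1, g2]
  have hli2 : LinearIndependent ℂ ![(Pi.single 0 1 : Fin (n + 1) → ℂ), Pi.single 1 1] := by
    have := hli.comp ![0, 1] (by decide)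
    convert this using 1
    ext a
    fin_cases a <;> rfl
  let π : (Fin (n + 1) → ℂ) →ₗ[ℂ] ℂ × ℂ := (LinearMap.proj 2).prod (LinearMap.proj 3)
  have hπ : Function.Surjective π := by
    rintro ⟨x, y⟩
    refine ⟨Pi.single 2 x + Pi.single 3 y, Prod.ext ?_ ?_⟩
    · simp [π, Pi.single_eq_of_ne (hne 2 3 (by omega))]
    · simp [π, Pi.single_eq_of_ne (hne 3 2 (by omega))]
  have hmW : ∀ w, w ∈ LinearMap.ker π ↔ w 2 = 0 ∧ w 3 = 0 := by
    intro w
    rw [LinearMap.mem_ker, Prod.ext_iff]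
    rfl
  refine ⟨span ℂ (Set.range ![(Pi.single 0 1 : Fin (n + 1) → ℂ), Pi.single 1 1]),
    span ℂ (Set.range ![(Pi.single 0 1 : Fin (n + 1) → ℂ), Pi.single 1 1, v]),
    LinearMap.ker π, ?_, ?_, ?_, ?_, ?_, ?_⟩
  · rw [span_range_triple, span_range_pair]
    exact le_sup_left
  · rw [span_le]
    rintro _ ⟨a, rfl⟩
    rw [SetLike.mem_coe, hmW]
    fin_cases a
    · exact ⟨Pi.single_eq_of_ne (hne 2 0 (by omega)) _, Pi.single_eq_of_ne (hne 3 0 (by omega)) _⟩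
    · exact ⟨Pi.single_eq_of_ne (hne 2 1 (by omega)) _, Pi.single_eq_of_ne (hne 3 1 (by omega)) _⟩
    · exact ⟨hvs 2 (by omega), hvs 3 (by omega)⟩
  · rw [finrank_span_eq_card hli2, Fintype.card_fin]
  · rw [finrank_span_eq_card hli, Fintype.card_fin]
  · rw [(π.quotKerEquivOfSurjective hπ).finrank_eq, finrank_prod, finrank_self]
  · intro l hl m hm w hw
    obtain ⟨hw2, hw3⟩ := (hmW w).1 hw
    induction hl using span_induction with
    | zero => simp
    | add x y _ _ hx hy => simp [hx, hy]
    | smul c x _ hx => simp [hx]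
    | mem x hx =>
      obtain ⟨a, rfl⟩ := hx
      induction hm using span_induction with
      | zero => simp
      | add x y _ _ hx hy => simp [hx, hy]
      | smul c x _ hx => simp [hx]
      | mem x hx =>
        obtain ⟨b, rfl⟩ := hx
        have s2 : ∀ b : Fin 3, ![(Pi.single 0 1 : Fin (n + 1) → ℂ), Pi.single 1 1, v] b 2 = 0 := by
          intro b
          fin_cases b
          exacts [Pi.single_eq_of_ne (hne 2 0 (by omega)) _,
            Pi.single_eq_of_ne (hne 2 1 (by omega)) _, hvs 2 (by omega)]
        have s3 : ∀ b : Fin 3, ![(Pi.single 0 1 : Fin (n + 1) → ℂ), Pi.single 1 1, v] b 3 = 0 := by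
          intro b
          fin_cases b
          exacts [Pi.single_eq_of_ne (hne 3 0 (by omega)) _,
            Pi.single_eq_of_ne (hne 3 1 (by omega)) _, hvs 3 (by omega)]
        have sD : ∀ (D : Matrix (Fin (n + 1)) (Fin (n + 1)) ℂ), D.IsSymm →
            (∀ i : Fin (n + 1), 4 ≤ (i : ℕ) → ∑ j ∈ tailIndices n, D i j * v j = 0) →
            ∀ b : Fin 3, tailBilin D
              (![(Pi.single 0 1 : Fin (n + 1) → ℂ), Pi.single 1 1, v] b) w = 0 := by
          intro D hD hDv b
          fin_cases b
          exacts [hhead D 0 w (by omega), hhead D 1 w (by omega), hker' D hD hDv w hw2 hw3]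
        fin_cases a
        · change polarForm (normalForm A B G) (Pi.single 0 1) _ w = 0
          rw [hT0, s2, hw2, sD A hA fun i hi => (hker i hi).1]
          ring
        · change polarForm (normalForm A B G) (Pi.single 1 1) _ w = 0
          rw [hT1, s3, hw3, sD B hB fun i hi => (hker i hi).2]
          ring

lemma IsHigherTripleLine.hasTripleFlag {n : ℕ} (hn : 4 ≤ n) {F : MvPolynomial (Fin (n + 1)) ℂ}
    (hF : F.IsHomogeneous 3) {L : Submodule ℂ (Fin (n + 1) → ℂ)} (h : IsHigherTripleLine F L) :
    HasTripleFlag (polarForm F) := by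
  obtain ⟨-, b, A, B, ⟨-, hA, hB, G, -, hGv, he⟩, hdeg⟩ := h
  have he' : linearSubst b F = normalForm A B G := he
  refine .of_linearSubst hF b ?_
  rw [he']
  exact hasTripleFlag_normalForm hn hA hB hGv (he' ▸ isHomogeneous_linearSubst b hF) hdeg

/-- A basis of `ℂ^{n+1}` adapted to a flag on which a smooth cubic vanishes. -/
structure AdaptedBasis {m : ℕ} (T : Trilinear (Fin (m + 4))) (L W : Submodule ℂ (Fin (m + 4) → ℂ))
    (b : Fin (m + 4) → Fin (m + 4) → ℂ) : Prop where
  span_eq : span ℂ {b 0, b 1} = L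
  mem : ∀ i : Fin m, b i.succ.succ.succ.succ ∈ W
  le : W ≤ L ⊔ span ℂ (Set.range fun i : Fin m => b i.succ.succ.succ.succ)
  top : ⊤ ≤ span ℂ (Set.range b)
  mixed₂ : T (b 0) (b 1) (b 2) = 0
  mixed₃ : T (b 0) (b 1) (b 3) = 0
  sq₀₂ : T (b 0) (b 0) (b 2) = 2
  sq₀₃ : T (b 0) (b 0) (b 3) = 0
  sq₁₂ : T (b 1) (b 1) (b 2) = 0
  sq₁₃ : T (b 1) (b 1) (b 3) = 2

/-- For l ≠ 0 in L, T(l, l, ·) is nonzero and kills W. Evaluated on a basis of a complement of W it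
gives two quadratic forms on L without common zero; they are diagonalized simultaneously, and the
basis of the complement is adjusted to match. -/
lemma exists_adaptedBasis {m : ℕ} {T : Trilinear (Fin (m + 4))}
    (h1 : ∀ u v w, T u v w = T v u w) {L W : Submodule ℂ (Fin (m + 4) → ℂ)} (hLW : L ≤ W)
    (hL : finrank ℂ L = 2) (hW : finrank ℂ ((Fin (m + 4) → ℂ) ⧸ W) = 2)
    (hT : ∀ l ∈ L, ∀ l' ∈ L, ∀ w ∈ W, T l l' w = 0)
    (hsm : ∀ l ∈ L, l ≠ 0 → T l l ≠ 0) : ∃ b, AdaptedBasis T L W b := by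
  have hV : finrank ℂ (Fin (m + 4) → ℂ) = m + 4 := by rw [finrank_pi, Fintype.card_fin]
  have cW := finrank_quotient_add_finrank W
  obtain ⟨Q, hQ⟩ := Submodule.exists_isCompl W
  have cQ := finrank_add_eq_of_isCompl hQ
  obtain ⟨N₀, hN₀⟩ := Submodule.exists_isCompl L
  have hLN : L ⊔ (W ⊓ N₀) = W := by
    rw [inf_comm, ← sup_inf_assoc_of_le N₀ hLW, hN₀.sup_eq_top, top_inf_eq]
  have hdis : L ⊓ (W ⊓ N₀) = ⊥ := by
    rw [inf_left_comm, hN₀.inf_eq_bot, inf_bot_eq]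
  have cN := finrank_sup_add_finrank_inf_eq L (W ⊓ N₀)
  rw [hLN, hdis, finrank_bot] at cN
  let ν : Basis (Fin m) ℂ ↥(W ⊓ N₀) := finBasisOfFinrankEq ℂ _ (by omega)
  let u : Basis (Fin 2) ℂ L := finBasisOfFinrankEq ℂ _ hL
  let c : Basis (Fin 2) ℂ Q := finBasisOfFinrankEq ℂ _ (by omega)
  have hspan : ∀ {k : ℕ} {U : Submodule ℂ (Fin (m + 4) → ℂ)} (β : Basis (Fin k) ℂ U),
      span ℂ (Set.range fun i => (β i : Fin (m + 4) → ℂ)) = U := by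
    intro k U β
    have := congrArg (Submodule.map U.subtype) β.span_eq
    rw [map_span, ← Set.range_comp, map_subtype_top] at this
    exact this
  have hu : LinearIndependent ℂ ![(u 0 : Fin (m + 4) → ℂ), u 1] := by
    have heq : ![(u 0 : Fin (m + 4) → ℂ), u 1] = L.subtype ∘ u := by
      ext i
      fin_cases i <;> rfl
    rw [heq]
    exact u.linearIndependent.map' L.subtype L.ker_subtype
  have hu' : span ℂ {(u 0 : Fin (m + 4) → ℂ), (u 1 : Fin (m + 4) → ℂ)} = L := by
    conv_rhs => rw [← hspan u]
    congr 1
    ext x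
    simp [Fin.exists_fin_two, eq_comm]
  have hc' : span ℂ {(c 0 : Fin (m + 4) → ℂ), (c 1 : Fin (m + 4) → ℂ)} = Q := by
    conv_rhs => rw [← hspan c]
    congr 1
    ext x
    simp [Fin.exists_fin_two, eq_comm]
  have hne : ∀ l ∈ L, l ≠ 0 → T l l (c 0) = 0 → T l l (c 1) ≠ 0 := by
    intro l hl hl0 hc0 hc1
    refine hsm l hl hl0 (LinearMap.ext fun x => ?_)
    have hx : x ∈ W ⊔ Q := hQ.sup_eq_top ▸ mem_top
    obtain ⟨w, hw, q, hq, rfl⟩ := mem_sup.1 hx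
    rw [← hc'] at hq
    obtain ⟨s, t, rfl⟩ := mem_span_pair.1 hq
    simp [hT l hl l hl w hw, hc0, hc1]
  obtain ⟨b₀, hb₀, b₁, hb₁, hli, hq, hr, hdet⟩ := exists_simultaneous_diagonalization hu
    (T.compr₂ (LinearMap.applyₗ (c 0 : Fin (m + 4) → ℂ)))
    (T.compr₂ (LinearMap.applyₗ (c 1 : Fin (m + 4) → ℂ)))
    (fun x y => h1 x y _) (fun x y => h1 x y _) (by
      intro x y hxy
      refine hne _ ?_ ?_
      · exact add_mem (smul_mem _ _ (u 0).2) (smul_mem _ _ (u 1).2)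
      · intro h0
        obtain ⟨h1, h2⟩ := LinearIndependent.pair_iff.1 hu x y h0
        rcases hxy with h | h
        exacts [h h1, h h2])
  rw [hu'] at hb₀ hb₁
  simp only [LinearMap.compr₂_apply, LinearMap.applyₗ_apply_apply] at hq hr hdet
  set q₀ := T b₀ b₀ (c 0)
  set q₁ := T b₁ b₁ (c 0)
  set r₀ := T b₀ b₀ (c 1)
  set r₁ := T b₁ b₁ (c 1)
  set δ := q₀ * r₁ - q₁ * r₀ with hδ
  -- Cramer's rule: c₂ and c₃ are dual, up to the factor 2, to T(b₀, b₀, ·) and T(b₁, b₁, ·). The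
  -- value 2 gives x_2 x_0² and x_3 x_1² coefficient one, as F is T(x, x, x) / 6.
  let c₂ : Fin (m + 4) → ℂ := (2 * r₁ / δ) • (c 0 : Fin (m + 4) → ℂ) - (2 * q₁ / δ) • (c 1 : Fin (m + 4) → ℂ)
  let c₃ : Fin (m + 4) → ℂ := (2 * q₀ / δ) • (c 1 : Fin (m + 4) → ℂ) - (2 * r₀ / δ) • (c 0 : Fin (m + 4) → ℂ)
  let b : Fin (m + 4) → Fin (m + 4) → ℂ :=
    Fin.cons b₀ (Fin.cons b₁ (Fin.cons c₂ (Fin.cons c₃ fun i => (ν i : Fin (m + 4) → ℂ))))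
  have e0 : b 0 = b₀ := rfl
  have e1 : b 1 = b₁ := rfl
  have e2 : b 2 = c₂ := rfl
  have e3 : b 3 = c₃ := rfl
  have e4 : ∀ i : Fin m, b i.succ.succ.succ.succ = ν i := fun i => rfl
  have hL' : span ℂ {b₀, b₁} = L := by
    refine eq_of_le_of_finrank_eq (span_le.2 ?_) ?_
    · rintro x (rfl | rfl)
      exacts [hb₀, hb₁]
    · have := finrank_span_eq_card hli
      rw [Matrix.range_cons_cons_empty] at this
      rw [this, hL, Fintype.card_fin]
  refine ⟨b, ⟨by rw [e0, e1, hL'], fun i => ?_, ?_, ?_, ?_, ?_, ?_, ?_, ?_, ?_⟩⟩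
  · rw [e4]
    exact (ν i).2.1
  · simp only [e4, hspan ν]
    exact hLN.ge
  · have hbm : ∀ i, b i ∈ span ℂ (Set.range b) := fun i => subset_span ⟨i, rfl⟩
    rw [← hQ.sup_eq_top, ← hLN, ← hL', ← hspan ν, ← hc']
    refine sup_le (sup_le (span_le.2 ?_) (span_le.2 ?_)) (span_le.2 ?_)
    · rintro x (rfl | rfl)
      exacts [hbm 0, hbm 1]
    · rintro _ ⟨i, rfl⟩
      exact hbm i.succ.succ.succ.succ
    · rintro x (rfl | rfl)
      · have : (c 0 : Fin (m + 4) → ℂ) = (q₀ / 2) • b 2 + (q₁ / 2) • b 3 := by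
          rw [e2, e3]
          ext i
          simp only [c₂, c₃, Pi.add_apply, Pi.sub_apply, Pi.smul_apply, smul_eq_mul]
          field_simp
          rw [hδ]
          ring
        rw [this]
        exact add_mem (smul_mem _ _ (hbm 2)) (smul_mem _ _ (hbm 3))
      · have : (c 1 : Fin (m + 4) → ℂ) = (r₀ / 2) • b 2 + (r₁ / 2) • b 3 := by
          rw [e2, e3]
          ext i
          simp only [c₂, c₃, Pi.add_apply, Pi.sub_apply, Pi.smul_apply, smul_eq_mul]
          field_simp
          rw [hδ]
          ring
        rw [this]
        exact add_mem (smul_mem _ _ (hbm 2)) (smul_mem _ _ (hbm 3))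
  · rw [e0, e1, e2]
    simp only [c₂, map_sub, map_smul, hq, hr, smul_zero, sub_zero]
  · rw [e0, e1, e3]
    simp only [c₃, map_sub, map_smul, hq, hr, smul_zero, sub_zero]
  · rw [e0, e2]
    simp only [c₂, map_sub, map_smul, smul_eq_mul]
    change 2 * r₁ / δ * q₀ - 2 * q₁ / δ * r₀ = 2
    field_simp
    rw [hδ]
    ring
  · rw [e0, e3]
    simp only [c₃, map_sub, map_smul, smul_eq_mul]
    change 2 * q₀ / δ * r₀ - 2 * r₀ / δ * q₀ = 0
    ring
  · rw [e1, e2]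
    simp only [c₂, map_sub, map_smul, smul_eq_mul]
    change 2 * r₁ / δ * q₁ - 2 * q₁ / δ * r₁ = 0
    ring
  · rw [e1, e3]
    simp only [c₃, map_sub, map_smul, smul_eq_mul]
    change 2 * q₀ / δ * r₁ - 2 * r₀ / δ * q₁ = 2
    field_simp
    rw [hδ]
    ring

end HigherTripleLines

/-! ### From a flag on a smooth cubic to a higher triple line. -/

noncomputable section FromFlag

open Module Submodule

lemma sum_eq_head_add_tail {m : ℕ} {V : Type*} [AddCommMonoid V] (f : Fin (m + 4) → V) :
    ∑ k, f k = f 0 + f 1 + ∑ k ∈ tailIndices (m + 3), f k := by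
  rw [← Finset.sum_filter_add_sum_filter_not Finset.univ fun k : Fin (m + 4) => 2 ≤ (k : ℕ),
    add_comm]
  congr 1
  have : (Finset.univ.filter fun k : Fin (m + 4) => ¬ 2 ≤ (k : ℕ)) = {0, 1} := by
    ext k
    have e1 : ((1 : Fin (m + 4)) : ℕ) = 1 := rfl
    rw [Finset.mem_filter, Finset.mem_insert, Finset.mem_singleton, Fin.ext_iff, Fin.ext_iff, e1,
      Fin.val_zero]
    simp only [Finset.mem_univ, true_and]
    omega
  rw [this, Finset.sum_pair (by simp)]

lemma mem_tailIndices_cases {m : ℕ} {k : Fin (m + 4)} (hk : k ∈ tailIndices (m + 3)) :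
    k = 2 ∨ k = 3 ∨ ∃ i : Fin m, k = i.succ.succ.succ.succ := by
  have h2 := (Finset.mem_filter.1 hk).2
  by_cases h : 4 ≤ (k : ℕ)
  · refine Or.inr (Or.inr ⟨⟨k - 4, by omega⟩, Fin.ext ?_⟩)
    simp
    omega
  · have e2 : ((2 : Fin (m + 4)) : ℕ) = 2 := rfl
    have e3 : ((3 : Fin (m + 4)) : ℕ) = 3 := rfl
    rw [Fin.ext_iff, Fin.ext_iff, e2, e3]
    omega

lemma AdaptedBasis.sum_tail {m : ℕ} {b : Fin (m + 4) → Fin (m + 4) → ℂ}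
    (φ : (Fin (m + 4) → ℂ) →ₗ[ℂ] ℂ)
    (hφ : ∀ i : Fin m, φ (b i.succ.succ.succ.succ) = 0) (x : Fin (m + 4) → ℂ) :
    φ (∑ k ∈ tailIndices (m + 3), x k • b k) = x 2 * φ (b 2) + x 3 * φ (b 3) := by
  have h23 : (2 : Fin (m + 4)) ≠ 3 := fun h => by
    have h' : (2 : ℕ) = 3 := congrArg Fin.val h
    omega
  rw [map_sum, ← Finset.sum_pair (f := fun k => x k * φ (b k)) h23]
  simp only [map_smul, smul_eq_mul]
  symm
  refine Finset.sum_subset (fun k hk => ?_) fun k hk hk' => ?_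
  · rw [Finset.mem_filter]
    rcases Finset.mem_insert.1 hk with rfl | hk
    · exact ⟨Finset.mem_univ _, le_rfl⟩
    · rw [Finset.mem_singleton.1 hk]
      exact ⟨Finset.mem_univ _, Nat.le_succ 2⟩
  · rcases mem_tailIndices_cases hk with rfl | rfl | ⟨i, rfl⟩
    · simp at hk'
    · simp at hk'
    · rw [hφ, mul_zero]

lemma AdaptedBasis.linearSubst_eq {m : ℕ} {F : MvPolynomial (Fin (m + 4)) ℂ}
    (hF : F.IsHomogeneous 3) {L W : Submodule ℂ (Fin (m + 4) → ℂ)}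
    {b : Fin (m + 4) → Fin (m + 4) → ℂ} (hb : AdaptedBasis (polarForm F) L W b) (hLW : L ≤ W)
    (hT : ∀ l ∈ L, ∀ l' ∈ L, ∀ w ∈ W, polarForm F l l' w = 0) :
    linearSubst b F = normalForm (n := m + 3) (fun i j => polarForm F (b 0) (b i) (b j) / 2)
      (fun i j => polarForm F (b 1) (b i) (b j) / 2)
      (∑ i ∈ tailIndices (m + 3), ∑ j ∈ tailIndices (m + 3), ∑ k ∈ tailIndices (m + 3),
        C (polarForm F (b i) (b j) (b k) / 6) * (X i * (X j * X k))) := by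
  set T := polarForm F with hTdef
  have s1 : ∀ u v w, T u v w = T v u w := polarForm_swap_left F
  have s2 : ∀ u v w, T u v w = T u w v := polarForm_swap_right F
  have m0 : b 0 ∈ L := hb.span_eq ▸ subset_span (by simp)
  have m1 : b 1 ∈ L := hb.span_eq ▸ subset_span (by simp)
  refine MvPolynomial.funext fun x => ?_
  rw [eval_linearSubst, sum_eq_head_add_tail]
  set z := ∑ k ∈ tailIndices (m + 3), x k • b k with hz
  have hsix : ∀ y, eval y F = T y y y / 6 := fun y => by
    rw [hTdef, polarForm_self hF]
    ring
  have z00 : T (b 0) (b 0) z = 2 * x 2 := by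
    rw [hz, AdaptedBasis.sum_tail _ (fun i => hT _ m0 _ m0 _ (hb.mem i)), hb.sq₀₂, hb.sq₀₃]
    ring
  have z01 : T (b 0) (b 1) z = 0 := by
    rw [hz, AdaptedBasis.sum_tail _ (fun i => hT _ m0 _ m1 _ (hb.mem i)), hb.mixed₂, hb.mixed₃]
    ring
  have z11 : T (b 1) (b 1) z = 2 * x 3 := by
    rw [hz, AdaptedBasis.sum_tail _ (fun i => hT _ m1 _ m1 _ (hb.mem i)), hb.sq₁₂, hb.sq₁₃]
    ring
  have zz : ∀ u, T u z z = ∑ i ∈ tailIndices (m + 3), ∑ j ∈ tailIndices (m + 3),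
      x i * x j * T u (b i) (b j) := by
    intro u
    simp only [hz, map_sum, LinearMap.sum_apply, map_smul, LinearMap.smul_apply, smul_eq_mul,
      Finset.mul_sum]
    rw [Finset.sum_comm]
    exact Finset.sum_congr rfl fun i _ => Finset.sum_congr rfl fun j _ => by ring
  have zzz : T z z z = ∑ i ∈ tailIndices (m + 3), ∑ j ∈ tailIndices (m + 3),
      ∑ k ∈ tailIndices (m + 3), x i * (x j * x k) * T (b i) (b j) (b k) := by
    rw [zz]
    simp only [hz, map_sum, LinearMap.sum_apply, map_smul, LinearMap.smul_apply, smul_eq_mul,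
      Finset.mul_sum]
    rw [Finset.sum_congr rfl fun i _ => Finset.sum_comm, Finset.sum_comm]
    exact Finset.sum_congr rfl fun i _ => Finset.sum_congr rfl fun j _ =>
      Finset.sum_congr rfl fun k _ => by ring
  have hll : ∀ a ∈ L, ∀ a' ∈ L, ∀ a'' ∈ L, T a a' a'' = 0 := fun a ha a' ha' a'' ha'' =>
    hT a ha a' ha' a'' (hLW ha'')
  -- In the expansion of T(x, x, x) / 6 the terms with three entries in L vanish, those with two
  -- give the quadratic head, and those with one, occurring three times, carry the factor 1/2.
  have hexp : eval (x 0 • b 0 + x 1 • b 1 + z) F = x 2 * x 0 ^ 2 + x 3 * x 1 ^ 2 +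
      (x 0 * T (b 0) z z / 2 + x 1 * T (b 1) z z / 2) + T z z z / 6 := by
    rw [hsix]
    simp only [map_add, map_smul, LinearMap.add_apply, LinearMap.smul_apply, smul_eq_mul,
      hll _ m0 _ m0 _ m0, hll _ m0 _ m0 _ m1, hll _ m0 _ m1 _ m0, hll _ m0 _ m1 _ m1,
      hll _ m1 _ m0 _ m0, hll _ m1 _ m0 _ m1, hll _ m1 _ m1 _ m0, hll _ m1 _ m1 _ m1,
      s1 (b 1) (b 0) z, s1 z (b 0), s1 z (b 1), s2 _ z (b 0), s2 _ z (b 1), z00, z01, z11]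
    ring
  rw [hexp, zz, zz, zzz]
  unfold normalForm
  simp only [map_add, map_mul, map_pow, eval_X, map_sum, eval_C, linearEntry]
  congr 1
  · congr 1
    rw [Finset.mul_sum, Finset.mul_sum, Finset.sum_div, Finset.sum_div, ← Finset.sum_add_distrib]
    refine Finset.sum_congr rfl fun i _ => ?_
    rw [Finset.mul_sum, Finset.mul_sum, Finset.sum_div, Finset.sum_div, ← Finset.sum_add_distrib]
    exact Finset.sum_congr rfl fun j _ => by ring
  · simp only [Finset.sum_div]
    exact Finset.sum_congr rfl fun i _ => Finset.sum_congr rfl fun j _ =>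
      Finset.sum_congr rfl fun k _ => by ring

lemma vars_tailCubic {n : ℕ} (t : Fin (n + 1) → Fin (n + 1) → Fin (n + 1) → ℂ) :
    ∀ l ∈ (∑ i ∈ tailIndices n, ∑ j ∈ tailIndices n, ∑ k ∈ tailIndices n,
      C (t i j k) * (X i * (X j * X k)) : MvPolynomial (Fin (n + 1)) ℂ).vars, 2 ≤ (l : ℕ) := by
  have hX : ∀ i ∈ tailIndices n, (X i : MvPolynomial (Fin (n + 1)) ℂ) ∈
      supported ℂ {l : Fin (n + 1) | 2 ≤ (l : ℕ)} := fun i hi =>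
    X_mem_supported.2 (Finset.mem_filter.1 hi).2
  have h : (∑ i ∈ tailIndices n, ∑ j ∈ tailIndices n, ∑ k ∈ tailIndices n,
      C (t i j k) * (X i * (X j * X k)) : MvPolynomial (Fin (n + 1)) ℂ) ∈
      supported ℂ {l : Fin (n + 1) | 2 ≤ (l : ℕ)} :=
    sum_mem fun i hi => sum_mem fun j hj => sum_mem fun k hk =>
      mul_mem (Subalgebra.algebraMap_mem _ _) (mul_mem (hX i hi) (mul_mem (hX j hj) (hX k hk)))
  intro l hl
  exact mem_supported.1 h hl

/-- Smoothness says that T(l, l, ·) ≠ 0 for nonzero l in L, since at a point of the cubic this is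
twice the gradient; this supplies the adapted basis. The space M supplies the dependency between
columns. -/
lemma exists_isHigherTripleLine {n : ℕ} (hn : 4 ≤ n) {F : MvPolynomial (Fin (n + 1)) ℂ}
    (hF : F.IsHomogeneous 3) (hsm : IsSmoothForm F) (h : HasTripleFlag (polarForm F)) :
    ∃ L, IsHigherTripleLine F L := by
  obtain ⟨m, rfl⟩ : ∃ m, n = m + 3 := ⟨n - 3, by omega⟩
  obtain ⟨L, M, W, hLM, hMW, hL, hM, hW, hT⟩ := h
  have hLW := hLM.trans hMW
  have hgrad : ∀ l ∈ L, l ≠ 0 → polarForm F l l ≠ 0 := by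
    intro l hl hl0 h0
    obtain ⟨i, hi⟩ := hsm l hl0 (by
      have := polarForm_self hF l
      rw [h0] at this
      simpa using this.symm)
    have := gradient_eq_polarForm hF l (Pi.single i 1)
    rw [h0, Finset.sum_eq_single i (by simp +contextual) (by simp)] at this
    simp at this
    exact hi this
  obtain ⟨b, hb⟩ := exists_adaptedBasis (polarForm_swap_left F) hLW hL hW
    (fun l hl l' hl' => hT l hl l' (hLM hl')) hgrad
  have hcard : Fintype.card (Fin (m + 3 + 1)) = finrank ℂ (Fin (m + 3 + 1) → ℂ) := by
    rw [finrank_pi]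
  let B := basisOfTopLeSpanOfCardEqFinrank b hb.top hcard
  have hB : (B : Fin (m + 3 + 1) → Fin (m + 3 + 1) → ℂ) = b :=
    coe_basisOfTopLeSpanOfCardEqFinrank b hb.top hcard
  have m0 : b 0 ∈ L := hb.span_eq ▸ subset_span (by simp)
  have m1 : b 1 ∈ L := hb.span_eq ▸ subset_span (by simp)
  refine ⟨L, ⟨hL, W, hW, hLW, fun p hp => ⟨?_, fun w hw => ?_⟩⟩, B,
    fun i j => polarForm F (b 0) (b i) (b j) / 2, fun i j => polarForm F (b 1) (b i) (b j) / 2,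
    ⟨by rw [hB, hb.span_eq], ?_, ?_, _, ?_,
      vars_tailCubic fun i j k => polarForm F (b i) (b j) (b k) / 6, ?_⟩, ?_⟩
  · have := polarForm_self hF p
    rw [hT p hp p (hLM hp) p (hLW hp)] at this
    simpa using this.symm
  · rw [gradient_eq_polarForm hF, hT p hp p (hLM hp) w hw, zero_div]
  · refine Matrix.IsSymm.ext fun i j => ?_
    rw [polarForm_swap_right]
  · refine Matrix.IsSymm.ext fun i j => ?_
    rw [polarForm_swap_right]
  · refine IsHomogeneous.sum _ _ _ fun i _ => IsHomogeneous.sum _ _ _ fun j _ =>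
      IsHomogeneous.sum _ _ _ fun k _ => ?_
    have h3 := (isHomogeneous_X ℂ i).mul ((isHomogeneous_X ℂ j).mul (isHomogeneous_X ℂ k))
    exact (h3.C_mul _)
  · have := AdaptedBasis.linearSubst_eq hF hb hLW fun l hl l' hl' => hT l hl l' (hLM hl')
    rw [← hB] at this ⊢
    exact this
  · obtain ⟨v, hvM, hvL⟩ : ∃ v ∈ M, v ∉ L := by
      by_contra hcon
      push Not at hcon
      have := Submodule.finrank_mono (show M ≤ L from hcon)
      omega
    -- Removing the component of v in L keeps T(L, ·, W) = 0; the rest is a nonzero combination of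
    -- the b_k with k ≥ 4, whose coefficients are the column relation.
    obtain ⟨l, hl, w, hw, rfl⟩ := mem_sup.1 (hb.le (hMW hvM))
    have hw0 : w ≠ 0 := by
      rintro rfl
      rw [add_zero] at hvL
      exact hvL hl
    have hrange : Set.range (fun i : Fin m => b i.succ.succ.succ.succ) ⊆
        Set.range fun k : {k : Fin (m + 3 + 1) // 4 ≤ (k : ℕ)} => b k.1 := by
      rintro _ ⟨i, rfl⟩
      exact ⟨⟨i.succ.succ.succ.succ, by simp⟩, rfl⟩
    obtain ⟨c, hc⟩ := (mem_span_range_iff_exists_fun ℂ).1 (span_mono hrange hw)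
    have hker : ∀ u ∈ L, ∀ i : {k : Fin (m + 3 + 1) // 4 ≤ (k : ℕ)},
        ∑ j, c j * (polarForm F u (b i.1) (b j.1)) = 0 := by
      intro u hu i
      have hi : b i.1 ∈ W := by
        have hmem : i.1 ∈ tailIndices (m + 3) := by
          have := i.2
          simp
          omega
        have e2 : ((2 : Fin (m + 4)) : ℕ) = 2 := rfl
        have e3 : ((3 : Fin (m + 4)) : ℕ) = 3 := rfl
        have h4 := i.2
        rcases mem_tailIndices_cases hmem with h | h | ⟨k, h⟩
        · rw [h] at h4
          omega
        · rw [h] at h4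
          omega
        · rw [h]
          exact hb.mem k
      have h1 := hT u hu _ hvM _ hi
      rw [map_add, LinearMap.add_apply, hT u hu l (hLM hl) _ hi, zero_add,
        polarForm_swap_right, ← hc, map_sum] at h1
      simpa using h1
    intro hli
    rw [Fintype.linearIndependent_iff] at hli
    refine hw0 ?_
    rw [← hc]
    refine Finset.sum_eq_zero fun j _ => ?_
    rw [hli c ?_ j, zero_smul]
    ext1 i
    simp only [Finset.sum_apply, Pi.smul_apply, Pi.zero_apply, linearEntry, smul_add,
      Finset.sum_add_distrib, smul_eq_C_mul, ← mul_assoc, ← Finset.sum_mul, ← map_mul, ← map_sum]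
    have k0 := hker _ m0 i
    have k1 := hker _ m1 i
    have hd : ∀ u, ∑ j, c j * (polarForm F u (b i.1) (b j.1) / 2) =
        (∑ j, c j * (polarForm F u (b i.1) (b j.1))) / 2 := fun u => by
      rw [Finset.sum_div]
      exact Finset.sum_congr rfl fun j _ => by ring
    rw [hd, hd, k0, k1]
    simp

end FromFlag

/-! ### The Zariski topology on the space of cubics; codimension. -/

noncomputable section Topology

namespace CubicHypersurface

variable {n : ℕ}

lemma isHomogeneous_equation (X : CubicHypersurface n) : X.equation.IsHomogeneous 3 :=
  (mem_homogeneousSubmodule _ _).1 (Projectivization.rep (K := ℂ) (V := CubicForm n) X).2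

/-- The cubic form with given coefficients. -/
def formOfCoeffs (c : CubicMonomial n → ℂ) : MvPolynomial (Fin (n + 1)) ℂ :=
  ∑ m : CubicMonomial n, monomial m.1 (c m)

lemma isHomogeneous_formOfCoeffs (c : CubicMonomial n → ℂ) : (formOfCoeffs c).IsHomogeneous 3 :=
  IsHomogeneous.sum _ _ _ fun m _ => isHomogeneous_monomial _ m.2

lemma coeff_formOfCoeffs (c : CubicMonomial n → ℂ) (m : CubicMonomial n) :
    coeff m.1 (formOfCoeffs c) = c m := by
  rw [formOfCoeffs, coeff_sum, Finset.sum_eq_single m]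
  · simp
  · intro m' _ h
    rw [coeff_monomial, if_neg fun h' => h (Subtype.ext h')]
  · simp

lemma formOfCoeffs_coeff {F : MvPolynomial (Fin (n + 1)) ℂ} (hF : F.IsHomogeneous 3) :
    formOfCoeffs (fun m => coeff m.1 F) = F := by
  ext m
  by_cases hm : m.degree = 3
  · exact coeff_formOfCoeffs _ ⟨m, hm⟩
  · rw [hF.coeff_eq_zero hm, (isHomogeneous_formOfCoeffs _).coeff_eq_zero hm]

lemma formOfCoeffs_coords (X : CubicHypersurface n) : formOfCoeffs X.coords = X.equation :=
  formOfCoeffs_coeff X.isHomogeneous_equation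

lemma formOfCoeffs_smul (t : ℂ) (c : CubicMonomial n → ℂ) :
    formOfCoeffs (t • c) = t • formOfCoeffs c := by
  simp [formOfCoeffs, Finset.smul_sum, smul_monomial]

/-- The scalar is unavoidable: `equation` is a chosen representative of the projective point. -/
lemma exists_coords_eq_smul {c : CubicMonomial n → ℂ} (hc : c ≠ 0) :
    ∃ (X : CubicHypersurface n) (t : ℂ), t ≠ 0 ∧ X.coords = t • c := by
  let v : CubicForm n := ⟨formOfCoeffs c, isHomogeneous_formOfCoeffs c⟩
  have hv : v ≠ 0 := by
    intro h
    refine hc (funext fun m => ?_)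
    have h' : formOfCoeffs c = 0 := congrArg Subtype.val h
    rw [← coeff_formOfCoeffs c m, h', coeff_zero, Pi.zero_apply]
  obtain ⟨t, ht⟩ := Projectivization.exists_smul_eq_mk_rep ℂ v hv
  refine ⟨Projectivization.mk ℂ v hv, t, t.ne_zero, funext fun m => ?_⟩
  have h : equation (Projectivization.mk ℂ v hv : CubicHypersurface n) =
      (t : ℂ) • formOfCoeffs c := congrArg Subtype.val ht.symm
  change coeff m.1 (equation (Projectivization.mk ℂ v hv : CubicHypersurface n)) = _
  rw [h, coeff_smul, coeff_formOfCoeffs]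
  rfl

lemma isClosed_iff {Z : Set (CubicHypersurface n)} : IsClosed Z ↔ IsZariskiClosed Z := by
  rw [← isOpen_compl_iff]
  change Zᶜᶜ ∈ {Z | IsZariskiClosed Z} ↔ _
  rw [compl_compl]
  rfl

lemma isClosed_of_algPred {P : (CubicMonomial n → ℂ) → Prop} (hP : AlgPred P)
    (hs : ∀ x (t : ℂ), t ≠ 0 → P x → P (t • x)) :
    IsClosed {X : CubicHypersurface n | P X.coords} := by
  obtain ⟨S, hS, h⟩ := hP.exists_homogeneous hs
  rw [isClosed_iff]
  refine ⟨S, hS, ?_⟩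
  ext X
  exact h X.coords

lemma exists_eval_ne_zero {Q : MvPolynomial (CubicMonomial n) ℂ} (hQ : Q ≠ 0) :
    ∃ c : CubicMonomial n → ℂ, c ≠ 0 ∧ eval c Q ≠ 0 := by
  let m₀ : CubicMonomial n := ⟨tripleExp 0 0 0, degree_tripleExp 0 0 0⟩
  -- The extra factor forces the point found to be nonzero, so that it defines a hypersurface.
  have h : Q * X m₀ ≠ 0 := mul_ne_zero hQ (X_ne_zero m₀)
  obtain ⟨c, hc⟩ : ∃ c, eval c (Q * X m₀) ≠ 0 := by
    by_contra hcon
    push Not at hcon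
    exact h (MvPolynomial.funext fun c => by rw [hcon c, map_zero])
  rw [map_mul, eval_X] at hc
  refine ⟨c, ?_, left_ne_zero_of_mul hc⟩
  rintro rfl
  exact right_ne_zero_of_mul hc rfl

lemma exists_polynomial_of_isOpen {U : Set (CubicHypersurface n)} (hU : IsOpen U)
    (hne : U.Nonempty) : ∃ (P : MvPolynomial (CubicMonomial n) ℂ) (d : ℕ), P.IsHomogeneous d ∧
      P ≠ 0 ∧ ∀ X : CubicHypersurface n, eval X.coords P ≠ 0 → X ∈ U := by
  obtain ⟨S, hS, hU'⟩ := isClosed_iff.1 hU.isClosed_compl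
  obtain ⟨X, hX⟩ := hne
  have hX' : X ∉ zeroLocus S := by
    rw [← hU']
    exact fun h => h hX
  simp only [zeroLocus, Set.mem_ofPred_eq, not_forall] at hX'
  obtain ⟨P, hP, hP0⟩ := hX'
  obtain ⟨d, hd⟩ := hS P hP
  refine ⟨P, d, hd, ?_, fun Y hY => ?_⟩
  · rintro rfl
    exact hP0 (map_zero _)
  · by_contra hYU
    have : Y ∈ zeroLocus S := by
      rw [← hU']
      exact hYU
    exact hY (this P hP)

/-- Each nonempty open set contains the nonvanishing locus of a nonzero homogeneous polynomial; a
product of two such polynomials is nonzero and hence nonzero at some point. -/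
instance : IrreducibleSpace (CubicHypersurface n) where
  isPreirreducible_univ := by
    rintro U V hU hV ⟨X, -, hX⟩ ⟨Y, -, hY⟩
    obtain ⟨P, d, hd, hP, hPU⟩ := exists_polynomial_of_isOpen hU ⟨X, hX⟩
    obtain ⟨Q, e, he, hQ, hQV⟩ := exists_polynomial_of_isOpen hV ⟨Y, hY⟩
    obtain ⟨c, hc, hPQ⟩ := exists_eval_ne_zero (mul_ne_zero hP hQ)
    obtain ⟨Z, t, ht, hZ⟩ := exists_coords_eq_smul hc
    have hev : ∀ {R : MvPolynomial (CubicMonomial n) ℂ} {k : ℕ}, R.IsHomogeneous k →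
        eval c R ≠ 0 → eval Z.coords R ≠ 0 := by
      intro R k hk hR
      have := eval₂_smul_of_isHomogeneous (RingHom.id ℂ) hk t c
      rw [hZ]
      change eval₂ (RingHom.id ℂ) (t • c) R ≠ 0
      rw [this]
      exact mul_ne_zero (pow_ne_zero _ ht) hR
    rw [map_mul] at hPQ
    exact ⟨Z, trivial, hPU Z (hev hd (left_ne_zero_of_mul hPQ)),
      hQV Z (hev he (right_ne_zero_of_mul hPQ))⟩
  toNonempty := by
    obtain ⟨c, hc, -⟩ := exists_eval_ne_zero (n := n) one_ne_zero
    obtain ⟨X, -⟩ := exists_coords_eq_smul hc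
    exact ⟨X⟩

/-- The form with coefficients `c` has a singular point. -/
def HasSingularPoint (c : CubicMonomial n → ℂ) : Prop :=
  ∃ p : Fin (n + 1) → ℂ, p ≠ 0 ∧
    (eval p (formOfCoeffs c) = 0 ∧ ∀ i, eval p (pderiv i (formOfCoeffs c)) = 0)

lemma isSmooth_iff (X : CubicHypersurface n) : X.IsSmooth ↔ ¬ HasSingularPoint X.coords := by
  rw [IsSmooth, IsSmoothForm, HasSingularPoint, formOfCoeffs_coords]
  push Not
  exact Iff.rfl

lemma HasSingularPoint.smul {c : CubicMonomial n → ℂ} (h : HasSingularPoint c) (t : ℂ) :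
    HasSingularPoint (t • c) := by
  obtain ⟨p, hp, h0, h1⟩ := h
  refine ⟨p, hp, ?_, fun i => ?_⟩
  · rw [formOfCoeffs_smul, smul_eval, h0, mul_zero]
  · rw [formOfCoeffs_smul, Derivation.map_smul, smul_eval, h1, mul_zero]

/-- The singular point is eliminated: the equations are polynomial in the coefficients and
homogeneous in the point. -/
lemma algPred_hasSingularPoint : AlgPred (HasSingularPoint (n := n)) := by
  refine AlgPred.exists_ne_zero (P := fun (c : CubicMonomial n → ℂ) p =>
    eval p (formOfCoeffs c) = 0 ∧ ∀ i, eval p (pderiv i (formOfCoeffs c)) = 0) ?_ ?_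
  · refine .and (.of_eq_zero ?_) (.all fun i => .of_eq_zero ?_)
    · simp only [formOfCoeffs, map_sum]
      refine .sum fun m => ?_
      have h := (IsPolyFun.coord (Sum.inl m)).mul
        (IsPolyFun.eval_fixed (monomial m.1 1) fun i => .coord
          (Sum.inr i : CubicMonomial n ⊕ Fin (n + 1)))
      convert h using 2 with z
      simp [eval_monomial]
    · simp only [formOfCoeffs, map_sum]
      refine .sum fun m => ?_
      have h := (IsPolyFun.coord (Sum.inl m)).mul
        (IsPolyFun.eval_fixed (pderiv i (monomial m.1 1)) fun i => .coord
          (Sum.inr i : CubicMonomial n ⊕ Fin (n + 1)))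
      convert h using 2 with z
      simp [pderiv_monomial, eval_monomial, mul_assoc]
  · rintro c p t - ⟨h0, h1⟩
    have hh := isHomogeneous_formOfCoeffs c
    refine ⟨?_, fun i => ?_⟩
    · have := eval₂_smul_of_isHomogeneous (RingHom.id ℂ) hh t p
      change eval₂ (RingHom.id ℂ) (t • p) _ = 0
      rw [this]
      exact mul_eq_zero_of_right _ h0
    · have := eval₂_smul_of_isHomogeneous (RingHom.id ℂ) (hh.pderiv (i := i)) t p
      change eval₂ (RingHom.id ℂ) (t • p) _ = 0
      rw [this]
      exact mul_eq_zero_of_right _ (h1 i)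

lemma isOpen_isSmooth : IsOpen {X : CubicHypersurface n | X.IsSmooth} := by
  have := isClosed_of_algPred (algPred_hasSingularPoint (n := n)) fun c t _ h => h.smul t
  rw [← isClosed_compl_iff]
  convert this using 1
  ext X
  simp [isSmooth_iff]

/-- The Fermat cubic is smooth. -/
lemma exists_isSmooth (n : ℕ) : ∃ X : CubicHypersurface n, X.IsSmooth := by
  let F : MvPolynomial (Fin (n + 1)) ℂ := ∑ i, X i ^ 3
  have hF : F.IsHomogeneous 3 := IsHomogeneous.sum _ _ _ fun i _ => isHomogeneous_X_pow i 3
  have hd : ∀ i, pderiv i F = 3 * X i ^ 2 := by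
    intro i
    simp only [F, map_sum]
    rw [Finset.sum_eq_single i]
    · simp
    · intro j _ hj
      simp [pderiv_X_of_ne hj]
    · simp
  have hns : ¬ HasSingularPoint fun m : CubicMonomial n => coeff m.1 F := by
    rintro ⟨p, hp, -, h⟩
    rw [formOfCoeffs_coeff hF] at h
    refine hp (funext fun i => ?_)
    have := h i
    rw [hd] at this
    simpa using this
  have hc : (fun m : CubicMonomial n => coeff m.1 F) ≠ 0 := by
    intro h0
    refine hns ⟨Pi.single 0 1, by simp, ?_, fun i => ?_⟩ <;>
    · rw [h0]
      simp [formOfCoeffs]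
  obtain ⟨Y, t, ht, hY⟩ := exists_coords_eq_smul hc
  refine ⟨Y, (isSmooth_iff Y).2 fun h => hns ?_⟩
  rw [hY] at h
  have := h.smul t⁻¹
  rwa [smul_smul, inv_mul_cancel₀ ht, one_smul] at this

/-- The form with coefficients `c` has a triple flag. -/
def CoeffsHaveTripleFlag (c : CubicMonomial n → ℂ) : Prop :=
  HasTripleFlag (polarForm (formOfCoeffs c))

lemma CoeffsHaveTripleFlag.smul {c : CubicMonomial n → ℂ} (h : CoeffsHaveTripleFlag c) (t : ℂ) :
    CoeffsHaveTripleFlag (t • c) := by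
  have hp : polarForm (formOfCoeffs (t • c)) = t • polarForm (formOfCoeffs c) := by
    ext u v w
    simp [polarForm, trilinearOf, thirdDerivs, formOfCoeffs_smul, Finset.smul_sum, smul_smul,
      mul_assoc]
  rw [CoeffsHaveTripleFlag, hp]
  exact HasTripleFlag.smul h t

lemma isClosed_hasTripleFlag (hn : 4 ≤ n) :
    IsClosed {X : CubicHypersurface n | HasTripleFlag (polarForm X.equation)} := by
  have halg : AlgPred (CoeffsHaveTripleFlag (n := n)) := by
    have := algPred_hasTripleFlag (ι := Fin (n + 1)) (by rw [Fintype.card_fin]; omega)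
      (t := fun i j k (c : CubicMonomial n → ℂ) =>
        c ⟨tripleExp i j k, degree_tripleExp i j k⟩ * derivFactor i j k)
      fun i j k => (IsPolyFun.coord _).mul (.const _)
    refine this.congr fun c => ?_
    have hc : thirdDerivs (formOfCoeffs c) = fun i j k =>
        c ⟨tripleExp i j k, degree_tripleExp i j k⟩ * derivFactor i j k := by
      funext i j k
      rw [thirdDerivs_eq_coeff, ← coeff_formOfCoeffs c]
    rw [CoeffsHaveTripleFlag, polarForm, hc]
  have := isClosed_of_algPred halg fun c t _ h => h.smul t
  simpa only [CoeffsHaveTripleFlag, formOfCoeffs_coords] using this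

lemma exists_not_hasTripleFlag (n : ℕ) :
    ∃ X : CubicHypersurface n, ¬ HasTripleFlag (polarForm X.equation) := by
  obtain ⟨Q, hQ, h⟩ := exists_relation_of_hasTripleFlag (Fin (n + 1))
  obtain ⟨c, hc, hQc⟩ := exists_eval_ne_zero hQ
  obtain ⟨X, t, ht, hX⟩ := exists_coords_eq_smul hc
  refine ⟨X, fun hflag => hQc ?_⟩
  rw [← formOfCoeffs_coords, hX] at hflag
  have h1 : CoeffsHaveTripleFlag (t⁻¹ • t • c) := CoeffsHaveTripleFlag.smul hflag t⁻¹
  rw [smul_smul, inv_mul_cancel₀ ht, one_smul] at h1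
  have := h _ (isHomogeneous_formOfCoeffs c) h1
  simpa only [coeff_formOfCoeffs] using this

lemma hasHigherTripleLine_iff (hn : 4 ≤ n) {X : CubicHypersurface n} (hX : X.IsSmooth) :
    X.HasHigherTripleLine ↔ HasTripleFlag (polarForm X.equation) :=
  ⟨fun ⟨_, h⟩ => h.hasTripleFlag hn X.isHomogeneous_equation,
    exists_isHigherTripleLine hn X.isHomogeneous_equation hX⟩

end CubicHypersurface

/-- Coheight zero means maximality among irreducible closed sets, and in an irreducible space only
the whole space is maximal; it is not contained in a proper closure. -/
lemma one_le_topologicalCodim {T : Type*} [TopologicalSpace T] [IrreducibleSpace T] {Y : Set T}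
    (h : closure Y ≠ Set.univ) : 1 ≤ topologicalCodim Y := by
  refine le_iInf fun Z => ?_
  rw [Order.one_le_iff_ne_zero, Order.coheight_ne_zero]
  intro hmax
  let top : TopologicalSpace.IrreducibleCloseds T :=
    ⟨Set.univ, IrreducibleSpace.isIrreducible_univ T, isClosed_univ⟩
  have hle : Z.1 ≤ top := fun x _ => Set.mem_univ x
  refine h (Set.eq_univ_of_univ_subset fun x hx => Z.2 (hmax hle hx))

end Topology

theorem mainTheorem6 (n : ℕ) (hn : 4 ≤ n) :
    IsClosed {X : SmoothCubicHypersurface n | X.1.HasHigherTripleLine} ∧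
    1 ≤ topologicalCodim {X : SmoothCubicHypersurface n | X.1.HasHigherTripleLine} ∧
    1 ≤ topologicalCodim {X : CubicHypersurface n | X.IsSmooth ∧ X.HasHigherTripleLine} ∧
    ∃ U : Set (CubicHypersurface n), IsOpen U ∧ U.Nonempty ∧ Dense U ∧
      ∀ X ∈ U, X.IsSmooth ∧ ¬ X.HasHigherTripleLine := by
  set Z := {X : CubicHypersurface n | HasTripleFlag (polarForm X.equation)} with hZdef
  have hZ : IsClosed Z := CubicHypersurface.isClosed_hasTripleFlag hn
  have hS : IsOpen {X : CubicHypersurface n | X.IsSmooth} := CubicHypersurface.isOpen_isSmooth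
  -- In an irreducible space two nonempty open sets meet: the smooth locus, containing the Fermat
  -- cubic, and the complement of the flag locus.
  have hne : ({X : CubicHypersurface n | X.IsSmooth} ∩ Zᶜ).Nonempty :=
    nonempty_preirreducible_inter hS hZ.isOpen_compl (CubicHypersurface.exists_isSmooth n)
      (CubicHypersurface.exists_not_hasTripleFlag n)
  have hU : IsOpen ({X : CubicHypersurface n | X.IsSmooth} ∩ Zᶜ) := hS.inter hZ.isOpen_compl
  have hclosed : IsClosed {X : SmoothCubicHypersurface n | X.1.HasHigherTripleLine} := by
    convert hZ.preimage (continuous_subtype_val (p := fun X : CubicHypersurface n => X.IsSmooth))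
      using 1
    ext X
    exact CubicHypersurface.hasHigherTripleLine_iff hn X.2
  obtain ⟨X₀, hX₀, hX₀Z⟩ := id hne
  have : IrreducibleSpace (SmoothCubicHypersurface n) :=
    { isPreirreducible_univ := (Subtype.preirreducibleSpace
        ((PreirreducibleSpace.isPreirreducible_univ).open_subset hS
          (Set.subset_univ _))).isPreirreducible_univ
      toNonempty := ⟨⟨X₀, hX₀⟩⟩ }
  refine ⟨hclosed, one_le_topologicalCodim ?_, one_le_topologicalCodim ?_, _, hU, hne,
    hU.dense hne, fun X hX => ⟨hX.1, fun h => hX.2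
      ((CubicHypersurface.hasHigherTripleLine_iff hn hX.1).1 h)⟩⟩
  · rw [hclosed.closure_eq]
    intro h
    have : (⟨X₀, hX₀⟩ : SmoothCubicHypersurface n) ∈
        {X : SmoothCubicHypersurface n | X.1.HasHigherTripleLine} := h ▸ Set.mem_univ _
    exact hX₀Z ((CubicHypersurface.hasHigherTripleLine_iff hn hX₀).1 this)
  · intro h
    -- On singular cubics the flag locus may differ from the higher triple line locus, but it is
    -- closed in the whole space and bounds the closure.
    have hsub : closure {X : CubicHypersurface n | X.IsSmooth ∧ X.HasHigherTripleLine} ⊆ Z :=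
      closure_minimal (fun X hX => (CubicHypersurface.hasHigherTripleLine_iff hn hX.1).1 hX.2) hZ
    exact hX₀Z (hsub (h ▸ Set.mem_univ X₀))
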